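/- Let $n,L\ge 1$, let $d_0,d_1,\dots,d_L$ be layer widths with $d_L=1$, and let $X\in\mathbb{R}^{n\times d_0}$, $y\in\mathbb{R}^n$. For matrices $\mathcal{W}=(W_1,\dots,W_L)$ with $W_k\in\mathbb{R}^{d_k\times d_{k-1}}$ (identified with a vector of all their entries, with its Euclidean norm), let $w_{\mathrm{prod}}=W_1^\top\cdots W_L^\top\in\mathbb{R}^{d_0}$ and $$R^1(w)=\tfrac1n\|y-Xw\|_2^2,\qquad R^L(\mathcal{W})=R^1(w_{\mathrm{prod}}).$$ Let $\hat\Sigma=\frac1n X^\top X$, let $\lambda$ and $\Lambda$ be its smallest nonzero and its largest eigenvalue, and let $w^\star$ be the minimizer of $R^1$ of smallest Euclidean norm. Let $S(\mathcal{W})$, the sharpness, be the largest eigenvalue of the Hessian of $R^L$ at $\mathcal{W}$, and let $S_{\min}=\inf S(\mathcal{W})$ over all global minimizers $\mathcal{W}$ of $R^L$. Let $(\mathcal{W}(t))_{t\ge 0}$ follow the gradient flow $\frac{d\mathcal{W}}{dt}=-\nabla R^L(\mathcal{W})$, and put $$\varepsilon=3\max_{1\le k\le L}\|W_k(0)\|_F^2+2\sum_{k=1}^{L-1}\big\|W_k(0)W_k(0)^\top-W_{k+1}(0)^\top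 W_{k+1}(0)\big\|_2 ,$$ where $\|\cdot\|_F$ is the Frobenius norm and $\|\cdot\|_2$ is the $\ell^2$ operator norm. Assume that * $(A_1)$ $R^L(\mathcal{W}(0))\le R^L(0)$ and $\nabla R^L(\mathcal{W}(0))\ne 0$; * $(A_2)$ $\hat\Sigma$ has full rank, $\varepsilon\le 1$, $\|w^\star\|_2\ge 1$ and $32L\sqrt{\varepsilon}\le 1$. Then $\mathcal{W}(t)$ converges, as $t\to\infty$, to a global minimizer $\mathcal{W}^{\mathrm{SI}}$ of $R^L$, and $$1\le\frac{S(\mathcal{W}^{\mathrm{SI}})}{S_{\min}}\le 4\,\frac{\Lambda}{\lambda}.$$ -/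

import Mathlib

noncomputable section

namespace DeepLinear

/-- The parameters `(W_1, …, W_L)` of a linear network of depth `L` with layer widths
`d 0, …, d L`, all entries being stacked in one Euclidean vector.  The block with index `k : Fin L`
is the matrix `W_{k+1}`, of size `d (k+1) × d k`. -/
abbrev Params (L : ℕ) (d : ℕ → ℕ) : Type :=
  EuclideanSpace ℝ (Σ k : Fin L, Fin (d (k + 1)) × Fin (d k))

/-- The weight matrix with (zero-based) index `k`. -/
def weight {L : ℕ} {d : ℕ → ℕ} (W : Params L d) (k : Fin L) :
    Matrix (Fin (d (k + 1))) (Fin (d k)) ℝ :=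
  Matrix.of fun i j => W ⟨k, (i, j)⟩

/-- The product `W_j ⋯ W_1` of the first `j` weight matrices. -/
def partialProd {L : ℕ} {d : ℕ → ℕ} (W : Params L d) :
    (j : ℕ) → j ≤ L → Matrix (Fin (d j)) (Fin (d 0)) ℝ
  | 0, _ => 1
  | j + 1, h => weight W ⟨j, h⟩ * partialProd W j (Nat.le_of_succ_le h)

/-- The vector `w_prod = W_1ᵀ ⋯ W_Lᵀ p`, so that the network is `x ↦ ⟨w_prod, x⟩`. -/
def wProd {L : ℕ} {d : ℕ → ℕ} (p : Fin (d L) → ℝ) (W : Params L d) :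
    EuclideanSpace ℝ (Fin (d 0)) :=
  WithLp.toLp 2 (Matrix.mulVec (partialProd W L le_rfl).transpose p)

/-- The risk of linear regression, `R¹(w) = (1/n) ‖y - X w‖²`. -/
def linRisk {n m : ℕ} (X : Matrix (Fin n) (Fin m) ℝ) (y : EuclideanSpace ℝ (Fin n))
    (w : EuclideanSpace ℝ (Fin m)) : ℝ :=
  1 / (n : ℝ) * ‖y - WithLp.toLp 2 (X.mulVec w)‖ ^ 2

/-- The empirical risk of the network, `R^L(W) = R¹(w_prod)`. -/
def risk {n L : ℕ} {d : ℕ → ℕ} (X : Matrix (Fin n) (Fin (d 0)) ℝ)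
    (y : EuclideanSpace ℝ (Fin n)) (p : Fin (d L) → ℝ) (W : Params L d) : ℝ :=
  linRisk X y (wProd p W)

/-- The set of global minimizers of a function. -/
def argminSet {α : Type*} (f : α → ℝ) : Set α := {x | ∀ x', f x ≤ f x'}

/-- `w` is the solution of smallest norm of the linear regression problem. -/
def IsLeastNormSolution {n m : ℕ} (X : Matrix (Fin n) (Fin m) ℝ)
    (y : EuclideanSpace ℝ (Fin n)) (w : EuclideanSpace ℝ (Fin m)) : Prop :=
  w ∈ argminSet (linRisk X y) ∧ ∀ v ∈ argminSet (linRisk X y), ‖w‖ ≤ ‖v‖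

/-- The empirical covariance matrix `(1/n) Xᵀ X`. -/
def empCov {n m : ℕ} (X : Matrix (Fin n) (Fin m) ℝ) : Matrix (Fin m) (Fin m) ℝ :=
  (1 / (n : ℝ)) • (X.transpose * X)

/-- The set of (real) eigenvalues of an endomorphism. -/
def eigenvalueSet {E : Type*} [AddCommGroup E] [Module ℝ E] (T : Module.End ℝ E) : Set ℝ :=
  {μ | T.HasEigenvalue μ}

/-- The largest eigenvalue `Λ` of the empirical covariance matrix. -/
def covMax {n m : ℕ} (X : Matrix (Fin n) (Fin m) ℝ) : ℝ :=
  sSup (eigenvalueSet (Matrix.toLin' (empCov X)))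

/-- The smallest nonzero eigenvalue `λ` of the empirical covariance matrix. -/
def covMin {n m : ℕ} (X : Matrix (Fin n) (Fin m) ℝ) : ℝ :=
  sInf (eigenvalueSet (Matrix.toLin' (empCov X)) \ {0})

/-- The Hessian of `f` at `x`, as the linear operator that is the derivative of the gradient. -/
def hessian {E : Type*} [NormedAddCommGroup E] [InnerProductSpace ℝ E] [CompleteSpace E]
    (f : E → ℝ) (x : E) : E →L[ℝ] E :=
  fderiv ℝ (gradient f) x

/-- The sharpness of `f` at `x`: the largest eigenvalue of the Hessian. -/
def sharpness {E : Type*} [NormedAddCommGroup E] [InnerProductSpace ℝ E] [CompleteSpace E]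
    (f : E → ℝ) (x : E) : ℝ :=
  sSup (eigenvalueSet (hessian f x).toLinearMap)

/-- The infimum of the sharpness over the global minimizers of `f`. -/
def minSharpness {E : Type*} [NormedAddCommGroup E] [InnerProductSpace ℝ E] [CompleteSpace E]
    (f : E → ℝ) : ℝ :=
  sInf (sharpness f '' argminSet f)

/-- `u : [0, ∞) → E` follows the gradient flow of `f`
(at time `0` the derivative is one-sided). -/
def IsGradientFlow {E : Type*} [NormedAddCommGroup E] [InnerProductSpace ℝ E] [CompleteSpace E]
    (f : E → ℝ) (u : ℝ → E) : Prop :=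
  ∀ t : ℝ, 0 ≤ t → HasDerivWithinAt u (-gradient f (u t)) (Set.Ici 0) t

/-- The squared Frobenius norm of a matrix. -/
def frobSq {a b : ℕ} (M : Matrix (Fin a) (Fin b) ℝ) : ℝ := ∑ i, ∑ j, M i j ^ 2

/-- The `ℓ²` operator norm of a square matrix. -/
def opNorm {a : ℕ} (M : Matrix (Fin a) (Fin a) ℝ) : ℝ := ‖Matrix.toEuclideanCLM (𝕜 := ℝ) M‖

/-- `ε = 3 max_k ‖W_k‖_F² + 2 ∑_{k=1}^{L-1} ‖W_k W_kᵀ - W_{k+1}ᵀ W_{k+1}‖₂`. -/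
def initEps {L : ℕ} {d : ℕ → ℕ} (W : Params L d) : ℝ :=
  3 * (⨆ k : Fin L, frobSq (weight W k)) +
    2 * ∑ k : Fin L, if h : (k : ℕ) + 1 < L then
      opNorm (weight W k * (weight W k).transpose -
        (weight W ⟨k + 1, h⟩).transpose * weight W ⟨k + 1, h⟩)
    else 0

end DeepLinear

end

/-!
# Sharpness of the limit of the gradient flow of a deep linear network

Write `J` for the derivative of `W ↦ w_prod` at `W`.  Its adjoint is backpropagation: `J† x` has
the blocks `bwd W (k + 1) (fwd W x k)ᵀ` (`adjoint_fderiv_wProd`).  Since the covariance `Σ` has full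
rank, the global minimizers of the risk are the parameters with `w_prod = w⋆`, and there the Hessian
is `2 J† Σ J` (`hessian_risk`), so that the sharpness is comparable to `‖J‖²` up to the extreme
eigenvalues of `Σ`.  Put `a = ‖w⋆‖ ^ (2 / L)`.

* Every minimizer has `‖J† w⋆‖² ≥ L a ^ (L - 1) ‖w⋆‖²`.  This is the inequality of arithmetic and
  geometric means for the squared norms of the `L` blocks of `J† w⋆`, with the Cauchy–Schwarz
  bound `‖fwd W w⋆ k‖ ‖bwd W k‖ ≥ ⟪w⋆, w_prod⟫ = ‖w⋆‖²` (`le_norm_sq_backprop`).  Hence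
  `S_min ≥ 2 λ L a ^ (L - 1)`.
* The imbalances `W_k W_kᵀ - W_{k+1}ᵀ W_{k+1}` are conserved by the flow (`hasDerivWithinAt_gap`).
  Let `D` be the sum of their operator norms, so that `2 D ≤ ε`, and let `s` be the squared norm of
  the last layer, a row vector.  Going down from the last layer, each layer has squared operator
  norm at most `s + D`, whence `‖J†‖² ≤ L (s + D) ^ (L - 1)` (`norm_sq_backprop_le`).  Conversely
  the squared norm of the backward signal grows by at least `s - D` at each layer, whence
  `(s - D) ^ L ≤ ‖w_prod‖²` if `D ≤ s` (`pow_le_bwd_zero_sq`).  In the limit this gives `s - D ≤ a`,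
  and `s + D ≤ a (1 + ε)` as `a ≥ 1`; the factor `(1 + ε) ^ (L - 1)` is at most `4`.
* The flow converges (`exists_tendsto_flow`): after a positive time the risk is below that of the
  zero network, hence `w_prod` stays away from `0`.  The bound `(s - D) ^ L ≤ ‖w_prod‖²` keeps the
  layers bounded, so that the block of the first layer in the gradient provides a
  Polyak–Łojasiewicz inequality, the risk decays exponentially, and the speed is integrable.
-/

noncomputable section

namespace DeepLinear

open Matrix

section

variable {L : ℕ} {d : ℕ → ℕ}

/-! ### Forward and backward propagation -/

/-- The weight matrix with index `k`, extended by zero to all `k : ℕ`.  This makes propagation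
through the layers a plain recursion over `ℕ`, without proofs of `k < L`. -/
def layer (W : Params L d) (k : ℕ) : Matrix (Fin (d (k + 1))) (Fin (d k)) ℝ :=
  if h : k < L then weight W ⟨k, h⟩ else 0

/-- The forward signal `W_k ⋯ W_1 x`. -/
def fwd (W : Params L d) (x : Fin (d 0) → ℝ) : (k : ℕ) → Fin (d k) → ℝ
  | 0 => x
  | k + 1 => layer W k *ᵥ fwd W x k

/-- The vector `W_{i+1}ᵀ ⋯ W_{i+m}ᵀ 1`, where `1` is the all-ones vector of dimension `d (i+m)`.
Only the case `i + m = L` matters; the all-ones vector exists in each dimension, so that no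
transport along an equality of natural numbers is needed. -/
def bwdIter (W : Params L d) : ℕ → (i : ℕ) → Fin (d i) → ℝ
  | 0, _ => 1
  | m + 1, i => (layer W i)ᵀ *ᵥ bwdIter W m (i + 1)

/-- The backward signal `W_{i+1}ᵀ ⋯ W_Lᵀ 1`. -/
def bwd (W : Params L d) (i : ℕ) : Fin (d i) → ℝ := bwdIter W (L - i) i

theorem layer_of_lt (W : Params L d) {k : ℕ} (h : k < L) : layer W k = weight W ⟨k, h⟩ :=
  dif_pos h

theorem layer_add_smul (W V : Params L d) (t : ℝ) (k : ℕ) :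
    layer (W + t • V) k = layer W k + t • layer V k := by
  unfold layer
  split_ifs
  · ext i j; simp [weight]
  · simp

theorem bwd_self (W : Params L d) : bwd W L = 1 := by
  simp [bwd, bwdIter]

theorem bwd_of_lt (W : Params L d) {i : ℕ} (h : i < L) :
    bwd W i = (layer W i)ᵀ *ᵥ bwd W (i + 1) := by
  have : L - i = (L - (i + 1)) + 1 := by omega
  rw [bwd, this, bwdIter, bwd]

theorem partialProd_transpose_mulVec_bwd (W : Params L d) (j : ℕ) (h : j ≤ L) :
    (partialProd W j h)ᵀ *ᵥ bwd W j = bwd W 0 := by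
  induction j with
  | zero => simp [partialProd]
  | succ j ih =>
    rw [← ih (Nat.le_of_succ_le h), partialProd, transpose_mul, ← mulVec_mulVec,
      bwd_of_lt W (Nat.lt_of_succ_le h), layer_of_lt W (Nat.lt_of_succ_le h)]

theorem wProd_one (W : Params L d) : wProd 1 W = WithLp.toLp 2 (bwd W 0) := by
  rw [wProd, ← partialProd_transpose_mulVec_bwd W L le_rfl, bwd_self]

theorem fwd_dotProduct_bwd (W : Params L d) (x : Fin (d 0) → ℝ) (k : ℕ) (h : k ≤ L) :
    fwd W x k ⬝ᵥ bwd W k = x ⬝ᵥ bwd W 0 := by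
  induction k with
  | zero => rfl
  | succ k ih =>
    rw [← ih (Nat.le_of_succ_le h), bwd_of_lt W (Nat.lt_of_succ_le h), fwd, mulVec_transpose,
      dotProduct_comm, dotProduct_mulVec, dotProduct_comm]

/-- The adjoint of the derivative at `W` of the map from the parameters to `w_prod`, applied to
`x`: the block of index `k` is the rank-one matrix `bwd W (k + 1) (fwd W x k)ᵀ`. -/
def backprop (W : Params L d) (x : Fin (d 0) → ℝ) : Params L d :=
  WithLp.toLp 2 fun e => bwd W (e.1 + 1) e.2.1 * fwd W x e.1 e.2.2

theorem layer_backprop (W : Params L d) (x : Fin (d 0) → ℝ) {k : ℕ} (h : k < L) :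
    layer (backprop W x) k = vecMulVec (bwd W (k + 1)) (fwd W x k) := by
  rw [layer_of_lt _ h]
  ext i j
  simp [weight, backprop, vecMulVec]

theorem inner_backprop (W V : Params L d) (x : Fin (d 0) → ℝ) :
    inner ℝ (backprop W x) V =
      ∑ k ∈ Finset.range L, fwd W x k ⬝ᵥ ((layer V k)ᵀ *ᵥ bwd W (k + 1)) := by
  rw [PiLp.inner_apply, Fintype.sum_sigma, Finset.sum_range]
  refine Finset.sum_congr rfl fun k _ => ?_
  rw [layer_of_lt V k.2, Fintype.sum_prod_type, Finset.sum_comm]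
  simp only [dotProduct, mulVec, transpose_apply, Finset.mul_sum]
  refine Finset.sum_congr rfl fun j _ => Finset.sum_congr rfl fun i _ => ?_
  simp [backprop, weight]
  ring

theorem norm_sq_backprop (W : Params L d) (x : Fin (d 0) → ℝ) :
    ‖backprop W x‖ ^ 2 = ∑ k ∈ Finset.range L,
      (bwd W (k + 1) ⬝ᵥ bwd W (k + 1)) * (fwd W x k ⬝ᵥ fwd W x k) := by
  rw [← real_inner_self_eq_norm_sq, inner_backprop]
  refine Finset.sum_congr rfl fun k hk => ?_
  rw [layer_backprop W x (Finset.mem_range.1 hk), transpose_vecMulVec, vecMulVec_mulVec]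
  simp [dotProduct_smul]

/-! ### Balanced layers -/

theorem dotProduct_sq_le {ι : Type*} [Fintype ι] (x z : ι → ℝ) :
    (x ⬝ᵥ z) ^ 2 ≤ (x ⬝ᵥ x) * (z ⬝ᵥ z) := by
  simpa [dotProduct, pow_two] using Finset.sum_mul_sq_le_sq_mul_sq Finset.univ x z

theorem real_dotProduct_self_nonneg {ι : Type*} [Fintype ι] (x : ι → ℝ) : 0 ≤ x ⬝ᵥ x :=
  Finset.sum_nonneg fun i _ => mul_self_nonneg (x i)

/-- A bound on the operator norm of `Mᵀ` is one on the operator norm of `M`. -/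
theorem mulVec_sq_le_of_transpose {a b : ℕ} (M : Matrix (Fin a) (Fin b) ℝ) {c : ℝ} (hc : 0 ≤ c)
    (h : ∀ x, (Mᵀ *ᵥ x) ⬝ᵥ (Mᵀ *ᵥ x) ≤ c * (x ⬝ᵥ x)) (x : Fin b → ℝ) :
    (M *ᵥ x) ⬝ᵥ (M *ᵥ x) ≤ c * (x ⬝ᵥ x) := by
  have h1 : (M *ᵥ x) ⬝ᵥ (M *ᵥ x) = (Mᵀ *ᵥ (M *ᵥ x)) ⬝ᵥ x := by
    rw [mulVec_transpose, dotProduct_mulVec]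
  have h2 := dotProduct_sq_le (Mᵀ *ᵥ (M *ᵥ x)) x
  rw [← h1] at h2
  have h3 := h (M *ᵥ x)
  set q := (M *ᵥ x) ⬝ᵥ (M *ᵥ x) with hq
  have hx := real_dotProduct_self_nonneg x
  rcases (real_dotProduct_self_nonneg (M *ᵥ x)).eq_or_lt with h0 | h0
  · rw [← hq] at h0
    rw [← h0]
    positivity
  · rw [← hq] at h0
    have h4 : q * q ≤ q * (c * (x ⬝ᵥ x)) := by
      calc q * q = q ^ 2 := by ring
        _ ≤ _ := h2
        _ ≤ c * q * (x ⬝ᵥ x) := mul_le_mul_of_nonneg_right h3 hx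
        _ = _ := by ring
    exact le_of_mul_le_mul_left h4 h0


/-- The defect from balance of two consecutive layers, `W_{k+1} W_{k+1}ᵀ - W_{k+2}ᵀ W_{k+2}` in
the one-based notation.  It is a conserved quantity of the gradient flow. -/
def gap (W : Params L d) (k : ℕ) : Matrix (Fin (d (k + 1))) (Fin (d (k + 1))) ℝ :=
  layer W k * (layer W k)ᵀ - (layer W (k + 1))ᵀ * layer W (k + 1)

theorem dotProduct_self_eq_norm_sq {m : ℕ} (w : EuclideanSpace ℝ (Fin m)) :
    w.ofLp ⬝ᵥ w.ofLp = ‖w‖ ^ 2 := by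
  rw [EuclideanSpace.real_norm_sq_eq]
  simp [dotProduct, pow_two]

theorem abs_dotProduct_mulVec_le_opNorm {a : ℕ} (M : Matrix (Fin a) (Fin a) ℝ) (x : Fin a → ℝ) :
    |x ⬝ᵥ (M *ᵥ x)| ≤ opNorm M * (x ⬝ᵥ x) := by
  have h1 := Matrix.inner_toEuclideanCLM M (WithLp.toLp 2 x) (WithLp.toLp 2 x)
  have h2 := dotProduct_self_eq_norm_sq (WithLp.toLp 2 x : EuclideanSpace ℝ (Fin a))
  rw [← h1, h2]
  refine (abs_real_inner_le_norm _ _).trans ?_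
  have h3 := (Matrix.toEuclideanCLM (𝕜 := ℝ) M).le_opNorm (WithLp.toLp 2 x)
  have h4 := mul_le_mul_of_nonneg_left h3 (norm_nonneg (WithLp.toLp 2 x : EuclideanSpace ℝ (Fin a)))
  rw [opNorm]
  linarith

theorem transpose_mulVec_sq_eq (W : Params L d) (k : ℕ) (x : Fin (d (k + 1)) → ℝ) :
    ((layer W k)ᵀ *ᵥ x) ⬝ᵥ ((layer W k)ᵀ *ᵥ x) =
      (layer W (k + 1) *ᵥ x) ⬝ᵥ (layer W (k + 1) *ᵥ x) + x ⬝ᵥ (gap W k *ᵥ x) := by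
  have h1 : ∀ {a b : ℕ} (M : Matrix (Fin a) (Fin b) ℝ) (z : Fin b → ℝ),
      (M *ᵥ z) ⬝ᵥ (M *ᵥ z) = z ⬝ᵥ ((Mᵀ * M) *ᵥ z) := by
    intro a b M z
    rw [← mulVec_mulVec, dotProduct_mulVec z, vecMul_transpose]
  rw [h1, h1, gap, transpose_transpose, sub_mulVec, dotProduct_sub]
  ring

/-- The number `δ k` bounds the imbalance of the layers `k` and `k + 1`. -/
def GapBound (W : Params L d) (δ : ℕ → ℝ) : Prop :=
  ∀ k, k + 1 < L → ∀ x, |x ⬝ᵥ (gap W k *ᵥ x)| ≤ δ k * (x ⬝ᵥ x)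

section

variable {N : ℕ}

/-- The squared norm of the last weight matrix, which is a row vector. -/
def lastSq (W : Params (N + 1) d) : ℝ := bwd W N ⬝ᵥ bwd W N

theorem lastSq_nonneg (W : Params (N + 1) d) : 0 ≤ lastSq W := real_dotProduct_self_nonneg _

theorem bwd_last_sq (hd : d (N + 1) = 1) (W : Params (N + 1) d) :
    bwd W (N + 1) ⬝ᵥ bwd W (N + 1) = 1 := by
  rw [bwd_self]; simp [dotProduct, hd]

theorem dotProduct_self_of_dim_one {m : ℕ} (hm : m = 1) (z : Fin m → ℝ) :
    z ⬝ᵥ z = (z ⬝ᵥ 1) ^ 2 := by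
  subst hm
  simp [dotProduct, pow_two]

theorem layer_last_sq_le (hd : d (N + 1) = 1) (W : Params (N + 1) d) (x : Fin (d N) → ℝ) :
    (layer W N *ᵥ x) ⬝ᵥ (layer W N *ᵥ x) ≤ lastSq W * (x ⬝ᵥ x) := by
  rw [dotProduct_self_of_dim_one hd, ← bwd_self W]
  have : layer W N *ᵥ x ⬝ᵥ bwd W (N + 1) = bwd W N ⬝ᵥ x := by
    rw [bwd_of_lt W (Nat.lt_succ_self N), mulVec_transpose, dotProduct_comm, dotProduct_mulVec]
  rw [this]
  exact dotProduct_sq_le _ _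

theorem layer_sq_le_Ico (hd : d (N + 1) = 1) (W : Params (N + 1) d) {δ : ℕ → ℝ}
    (h0 : ∀ k, 0 ≤ δ k) (hδ : GapBound W δ) (m k : ℕ) (hk : k + m = N) (x : Fin (d k) → ℝ) :
    (layer W k *ᵥ x) ⬝ᵥ (layer W k *ᵥ x) ≤
      (lastSq W + ∑ j ∈ Finset.Ico k N, δ j) * (x ⬝ᵥ x) := by
  induction m generalizing k with
  | zero =>
    obtain rfl : k = N := hk
    simpa using layer_last_sq_le hd W x
  | succ m ih =>
    refine mulVec_sq_le_of_transpose _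
      (add_nonneg (lastSq_nonneg W) (Finset.sum_nonneg fun j _ => h0 j)) (fun z => ?_) x
    rw [transpose_mulVec_sq_eq, Finset.sum_eq_sum_Ico_succ_bot (by omega)]
    have h1 := ih (k + 1) (by omega) z
    have h2 := (abs_le.1 (hδ k (by omega) z)).2
    linarith

/-- All layers of an almost balanced network have almost the norm of the last one. -/
theorem layer_sq_le (hd : d (N + 1) = 1) (W : Params (N + 1) d) {δ : ℕ → ℝ}
    (h0 : ∀ k, 0 ≤ δ k) (hδ : GapBound W δ) {k : ℕ} (hk : k ≤ N) (x : Fin (d k) → ℝ) :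
    (layer W k *ᵥ x) ⬝ᵥ (layer W k *ᵥ x) ≤
      (lastSq W + ∑ j ∈ Finset.range N, δ j) * (x ⬝ᵥ x) := by
  refine (layer_sq_le_Ico hd W h0 hδ (N - k) k (by omega) x).trans ?_
  refine mul_le_mul_of_nonneg_right ?_ (real_dotProduct_self_nonneg x)
  refine (add_le_add_iff_left _).2 (Finset.sum_le_sum_of_subset_of_nonneg ?_ fun j _ _ => h0 j)
  intro j hj
  simp at hj ⊢
  omega

theorem layer_transpose_sq_le (hd : d (N + 1) = 1) (W : Params (N + 1) d) {δ : ℕ → ℝ}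
    (h0 : ∀ k, 0 ≤ δ k) (hδ : GapBound W δ) {k : ℕ} (hk : k ≤ N) (x : Fin (d (k + 1)) → ℝ) :
    ((layer W k)ᵀ *ᵥ x) ⬝ᵥ ((layer W k)ᵀ *ᵥ x) ≤
      (lastSq W + ∑ j ∈ Finset.range N, δ j) * (x ⬝ᵥ x) := by
  refine mulVec_sq_le_of_transpose _
    (add_nonneg (lastSq_nonneg W) (Finset.sum_nonneg fun j _ => h0 j)) (fun z => ?_) x
  rw [transpose_transpose]
  exact layer_sq_le hd W h0 hδ hk z

theorem fwd_sq_le (hd : d (N + 1) = 1) (W : Params (N + 1) d) {δ : ℕ → ℝ}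
    (h0 : ∀ k, 0 ≤ δ k) (hδ : GapBound W δ) (x : Fin (d 0) → ℝ) (k : ℕ) (hk : k ≤ N + 1) :
    fwd W x k ⬝ᵥ fwd W x k ≤ (lastSq W + ∑ j ∈ Finset.range N, δ j) ^ k * (x ⬝ᵥ x) := by
  have hc := add_nonneg (lastSq_nonneg W) (Finset.sum_nonneg fun j (_ : j ∈ Finset.range N) => h0 j)
  induction k with
  | zero => simp [fwd]
  | succ k ih =>
    have h1 := layer_sq_le hd W h0 hδ (by omega : k ≤ N) (fwd W x k)
    have h2 := mul_le_mul_of_nonneg_left (ih (by omega)) hc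
    rw [fwd, pow_succ']
    linarith

theorem bwd_sq_le (hd : d (N + 1) = 1) (W : Params (N + 1) d) {δ : ℕ → ℝ}
    (h0 : ∀ k, 0 ≤ δ k) (hδ : GapBound W δ) (m k : ℕ) (hk : k + m = N + 1) :
    bwd W k ⬝ᵥ bwd W k ≤ (lastSq W + ∑ j ∈ Finset.range N, δ j) ^ m := by
  have hc := add_nonneg (lastSq_nonneg W) (Finset.sum_nonneg fun j (_ : j ∈ Finset.range N) => h0 j)
  induction m generalizing k with
  | zero =>
    obtain rfl : k = N + 1 := hk
    simp [bwd_last_sq hd]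
  | succ m ih =>
    have h1 := layer_transpose_sq_le hd W h0 hδ (by omega : k ≤ N) (bwd W (k + 1))
    have h2 := mul_le_mul_of_nonneg_left (ih (k + 1) (by omega)) hc
    rw [bwd_of_lt W (by omega : k < N + 1), pow_succ']
    linarith

theorem norm_sq_backprop_le (hd : d (N + 1) = 1) (W : Params (N + 1) d) {δ : ℕ → ℝ}
    (h0 : ∀ k, 0 ≤ δ k) (hδ : GapBound W δ) (x : Fin (d 0) → ℝ) :
    ‖backprop W x‖ ^ 2 ≤
      (N + 1) * (lastSq W + ∑ j ∈ Finset.range N, δ j) ^ N * (x ⬝ᵥ x) := by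
  have hc := add_nonneg (lastSq_nonneg W) (Finset.sum_nonneg fun j (_ : j ∈ Finset.range N) => h0 j)
  rw [norm_sq_backprop]
  calc _ ≤ ∑ k ∈ Finset.range (N + 1),
        (lastSq W + ∑ j ∈ Finset.range N, δ j) ^ N * (x ⬝ᵥ x) := by
        refine Finset.sum_le_sum fun k hk => ?_
        have hk' : k ≤ N := by simp at hk; omega
        have h1 := bwd_sq_le hd W h0 hδ (N - k) (k + 1) (by omega)
        have h2 := fwd_sq_le hd W h0 hδ x k (by omega)
        refine (mul_le_mul h1 h2 (real_dotProduct_self_nonneg _) (by positivity)).trans_eq ?_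
        rw [← mul_assoc, ← pow_add]
        congr 3
        omega
    _ = _ := by simp; ring

/-- The norm of the backward signal grows by a factor of almost the norm of the last layer at
each step: by Cauchy–Schwarz the growth factors of a balanced network are monotone. -/
theorem mul_bwd_sq_le (hd : d (N + 1) = 1) (W : Params (N + 1) d) {δ : ℕ → ℝ}
    (hδ : GapBound W δ) (m k : ℕ) (hk : k + m = N) :
    (lastSq W - ∑ j ∈ Finset.Ico k N, δ j) * (bwd W (k + 1) ⬝ᵥ bwd W (k + 1)) ≤
      bwd W k ⬝ᵥ bwd W k := by
  induction m generalizing k with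
  | zero =>
    obtain rfl : k = N := hk
    simp [bwd_last_sq hd, lastSq]
  | succ m ih =>
    have h1 := ih (k + 1) (by omega)
    have h2 := (abs_le.1 (hδ k (by omega) (bwd W (k + 1)))).1
    have h3 := transpose_mulVec_sq_eq W k (bwd W (k + 1))
    rw [← bwd_of_lt W (by omega : k < N + 1)] at h3
    rw [Finset.sum_eq_sum_Ico_succ_bot (by omega)]
    have h4 := dotProduct_sq_le (layer W (k + 1) *ᵥ bwd W (k + 1)) (bwd W (k + 1 + 1))
    have h5 : layer W (k + 1) *ᵥ bwd W (k + 1) ⬝ᵥ bwd W (k + 1 + 1) =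
        bwd W (k + 1) ⬝ᵥ bwd W (k + 1) := by
      conv_rhs => rw [bwd_of_lt W (by omega : k + 1 < N + 1), mulVec_transpose, ← dotProduct_mulVec,
        ← mulVec_transpose, ← bwd_of_lt W (by omega : k + 1 < N + 1), dotProduct_comm]
    rw [h5] at h4
    set ρ := lastSq W - ∑ j ∈ Finset.Ico (k + 1) N, δ j with hρ
    set p := bwd W (k + 1) ⬝ᵥ bwd W (k + 1) with hp
    set q := bwd W (k + 1 + 1) ⬝ᵥ bwd W (k + 1 + 1) with hq
    set r := layer W (k + 1) *ᵥ bwd W (k + 1) ⬝ᵥ layer W (k + 1) *ᵥ bwd W (k + 1) with hr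
    have hp0 : 0 ≤ p := real_dotProduct_self_nonneg _
    have hr0 : 0 ≤ r := real_dotProduct_self_nonneg _
    have key : ρ * p ≤ r := by
      rcases (real_dotProduct_self_nonneg (bwd W (k + 1 + 1))).eq_or_lt with hq0 | hq0
      · rw [← hq] at hq0
        rw [← hq0, mul_zero] at h4
        have : p = 0 := pow_eq_zero_iff two_ne_zero |>.1 (le_antisymm h4 (sq_nonneg p))
        rw [this, mul_zero]
        exact hr0
      · rw [← hq] at hq0
        refine le_of_mul_le_mul_right ?_ hq0
        calc ρ * p * q = p * (ρ * q) := by ring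
          _ ≤ p * p := mul_le_mul_of_nonneg_left h1 hp0
          _ = p ^ 2 := by ring
          _ ≤ r * q := h4
    have : lastSq W - (δ k + ∑ j ∈ Finset.Ico (k + 1) N, δ j) = ρ - δ k := by rw [hρ]; ring
    rw [this]
    linarith

/-- The product vector of an almost balanced network has almost the largest norm that the norms
of the layers allow. -/
theorem pow_le_bwd_zero_sq (hd : d (N + 1) = 1) (W : Params (N + 1) d) {δ : ℕ → ℝ}
    (h0 : ∀ k, 0 ≤ δ k) (hδ : GapBound W δ) (hs : ∑ j ∈ Finset.range N, δ j ≤ lastSq W) :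
    (lastSq W - ∑ j ∈ Finset.range N, δ j) ^ (N + 1) ≤ bwd W 0 ⬝ᵥ bwd W 0 := by
  have hs' := sub_nonneg.2 hs
  have key : ∀ m k, k + m = N + 1 →
      (lastSq W - ∑ j ∈ Finset.range N, δ j) ^ m ≤ bwd W k ⬝ᵥ bwd W k := by
    intro m
    induction m with
    | zero =>
      intro k hk
      obtain rfl : k = N + 1 := hk
      simp [bwd_last_sq hd]
    | succ m ih =>
      intro k hk
      refine le_trans ?_ (mul_bwd_sq_le hd W hδ (N - k) k (by omega))
      rw [pow_succ']
      refine mul_le_mul ?_ (ih (k + 1) (by omega)) (by positivity) ?_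
      all_goals
        have : ∑ j ∈ Finset.Ico k N, δ j ≤ ∑ j ∈ Finset.range N, δ j :=
          Finset.sum_le_sum_of_subset_of_nonneg (by intro j hj; simp at hj ⊢; omega)
            fun j _ _ => h0 j
        linarith
  exact key _ _ (by omega)

/-- A lower bound on the norm of the derivative of `w_prod`, whatever the balance of the layers.
It comes from the inequality of arithmetic and geometric means and, for `x = bwd W 0`, from
`fwd W x k ⬝ᵥ bwd W k = x ⬝ᵥ x`. -/
theorem le_norm_sq_backprop (hd : d (N + 1) = 1) (W : Params (N + 1) d) {a : ℝ} (ha : 0 < a)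
    (haw : a ^ (N + 1) = bwd W 0 ⬝ᵥ bwd W 0) :
    (N + 1) * a ^ (2 * N + 1) ≤ ‖backprop W (bwd W 0)‖ ^ 2 := by
  rw [norm_sq_backprop]
  set A : ℕ → ℝ := fun k => fwd W (bwd W 0) k ⬝ᵥ fwd W (bwd W 0) k with hA
  set q : ℕ → ℝ := fun k => bwd W k ⬝ᵥ bwd W k with hq
  have hA0 : ∀ k, 0 ≤ A k := fun k => real_dotProduct_self_nonneg _
  have hq0 : ∀ k, 0 ≤ q k := fun k => real_dotProduct_self_nonneg _
  have h1 : ∀ k ∈ Finset.range N, (a ^ (N + 1)) ^ 2 ≤ A (k + 1) * q (k + 1) := by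
    intro k hk
    have hk' : k + 1 ≤ N + 1 := by simp at hk; omega
    rw [haw, ← fwd_dotProduct_bwd W _ (k + 1) hk']
    exact dotProduct_sq_le _ _
  have h2 : a ^ ((N + 1) * (2 * N + 1)) ≤ ∏ k ∈ Finset.range (N + 1), q (k + 1) * A k := by
    rw [Finset.prod_mul_distrib, Finset.prod_range_succ, Finset.prod_range_succ']
    have h3 := Finset.prod_le_prod (fun k _ => by positivity) h1
    rw [Finset.prod_mul_distrib, Finset.prod_const, Finset.card_range] at h3
    have hA' : A 0 = a ^ (N + 1) := haw.symm
    have hq' : q (N + 1) = 1 := bwd_last_sq hd W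
    rw [hA', hq']
    have h4 := mul_le_mul_of_nonneg_right h3 (by positivity : 0 ≤ a ^ (N + 1))
    refine le_trans (le_of_eq ?_) (h4.trans (le_of_eq ?_)) <;> ring
  have h5 := Real.geom_mean_le_arith_mean (Finset.range (N + 1)) (fun _ => 1)
    (fun k => q (k + 1) * A k) (fun _ _ => zero_le_one) (by simp; positivity)
    (fun k _ => mul_nonneg (hq0 _) (hA0 _))
  simp only [Real.rpow_one, Finset.sum_const, Finset.card_range, nsmul_eq_mul, mul_one, one_mul]
    at h5
  have h6 : a ^ (2 * N + 1) ≤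
      (∏ k ∈ Finset.range (N + 1), q (k + 1) * A k) ^ (((N + 1 : ℕ) : ℝ)⁻¹) := by
    refine le_trans (le_of_eq ?_) (Real.rpow_le_rpow (by positivity) h2 (by positivity))
    rw [pow_mul', Real.pow_rpow_inv_natCast (by positivity) (by omega)]
  have h7 := h6.trans h5
  rw [le_div_iff₀ (by positivity)] at h7
  push_cast at h7
  linarith

end

end

/-! ### Extreme eigenvalues of symmetric operators -/

section

variable {E F : Type*} [NormedAddCommGroup E] [InnerProductSpace ℝ E]
  [NormedAddCommGroup F] [InnerProductSpace ℝ F]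

theorem finite_eigenvalueSet [FiniteDimensional ℝ E] (T : Module.End ℝ E) :
    (eigenvalueSet T).Finite :=
  Module.End.finite_hasEigenvalue T

theorem inner_le_sSup_eigenvalueSet [FiniteDimensional ℝ E] {T : Module.End ℝ E}
    (hT : LinearMap.IsSymmetric T) (x : E) :
    inner ℝ (T x) x ≤ sSup (eigenvalueSet T) * ‖x‖ ^ 2 := by
  set e := hT.eigenvectorBasis rfl
  have h1 : ∀ i, inner ℝ (T x) (e i) = hT.eigenvalues rfl i * inner ℝ x (e i) := fun i => by
    rw [hT, hT.apply_eigenvectorBasis rfl i, inner_smul_right]; rfl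
  rw [← real_inner_self_eq_norm_sq, ← e.sum_inner_mul_inner, ← e.sum_inner_mul_inner x x,
    Finset.mul_sum]
  refine Finset.sum_le_sum fun i _ => ?_
  rw [h1, mul_assoc, real_inner_comm x (e i)]
  exact mul_le_mul_of_nonneg_right (le_csSup (finite_eigenvalueSet T).bddAbove
    (hT.hasEigenvalue_eigenvalues rfl i)) (mul_self_nonneg _)

theorem sInf_eigenvalueSet_le_inner [FiniteDimensional ℝ E] {T : Module.End ℝ E}
    (hT : LinearMap.IsSymmetric T) (x : E) :
    sInf (eigenvalueSet T) * ‖x‖ ^ 2 ≤ inner ℝ (T x) x := by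
  set e := hT.eigenvectorBasis rfl
  have h1 : ∀ i, inner ℝ (T x) (e i) = hT.eigenvalues rfl i * inner ℝ x (e i) := fun i => by
    rw [hT, hT.apply_eigenvectorBasis rfl i, inner_smul_right]; rfl
  rw [← real_inner_self_eq_norm_sq, ← e.sum_inner_mul_inner (T x) x, ← e.sum_inner_mul_inner x x,
    Finset.mul_sum]
  refine Finset.sum_le_sum fun i _ => ?_
  rw [h1, mul_assoc, real_inner_comm x (e i)]
  exact mul_le_mul_of_nonneg_right (csInf_le (finite_eigenvalueSet T).bddBelow
    (hT.hasEigenvalue_eigenvalues rfl i)) (mul_self_nonneg _)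

/-! ### Gradient and Hessian of a quadratic function of a nonlinear map -/

/-- At a zero of `h`, the derivative of `x ↦ A x (h x)` only needs continuity of `A`. -/
theorem hasFDerivAt_apply_of_eq_zero {G : Type*} [NormedAddCommGroup G] [NormedSpace ℝ G]
    {A : E → F →L[ℝ] G} {h : E → F} {h' : E →L[ℝ] F} {x : E} (hA : ContinuousAt A x)
    (hh : HasFDerivAt h h' x) (h0 : h x = 0) :
    HasFDerivAt (fun z => A z (h z)) ((A x).comp h') x := by
  have h1 : HasFDerivAt (fun z => A x (h z)) ((A x).comp h') x := (A x).hasFDerivAt.comp x hh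
  have h2 : HasFDerivAt (fun z => (A z - A x) (h z)) (0 : E →L[ℝ] G) x := by
    rw [hasFDerivAt_iff_isLittleO]
    simp only [h0, map_zero, sub_zero, _root_.zero_apply]
    have h3 : (fun z => A z - A x) =o[nhds x] (fun _ => (1 : ℝ)) := by
      rw [Asymptotics.isLittleO_one_iff]
      simpa using hA.tendsto.sub_const (A x)
    have h4 : h =O[nhds x] (fun z => z - x) := by
      simpa [h0] using hh.isBigO_sub
    have h5 := h3.norm_left.mul_isBigO h4.norm_norm
    refine Asymptotics.IsBigO.trans_isLittleO (Asymptotics.IsBigO.of_bound 1 ?_)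
      (h5.congr_right fun z => one_mul _ |>.trans rfl) |>.trans_isBigO
      (Asymptotics.isBigO_refl _ _).norm_left
    filter_upwards with z
    simpa using (A z - A x).le_opNorm (h z)
  refine ((h1.add h2).congr_fderiv (add_zero _)).congr_of_eventuallyEq ?_
  filter_upwards with z
  simp

variable [CompleteSpace E] [CompleteSpace F]

theorem hasGradientAt_quadratic_comp {P : E → F} {T : F →L[ℝ] F}
    (hT : ∀ x y, inner ℝ (T x) y = inner ℝ x (T y)) (w : F) (c : ℝ) {x : E}
    (hP : DifferentiableAt ℝ P x) :
    HasGradientAt (fun z => c + inner ℝ (T (P z - w)) (P z - w) / 2)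
      ((fderiv ℝ P x).adjoint (T (P x - w))) x := by
  rw [hasGradientAt_iff_hasFDerivAt]
  have h1 : HasFDerivAt (fun z => P z - w) (fderiv ℝ P x) x := hP.hasFDerivAt.sub_const w
  have h2 : HasFDerivAt (fun z => T (P z - w)) (T.comp (fderiv ℝ P x)) x :=
    T.hasFDerivAt.comp x h1
  have h3 := ((h2.inner ℝ h1).mul_const (2⁻¹ : ℝ)).const_add c
  simp only [div_eq_mul_inv]
  refine HasFDerivAt.congr_fderiv (f := fun z => c + inner ℝ (T (P z - w)) (P z - w) * 2⁻¹) h3 ?_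
  ext v
  have h4 : inner ℝ (T (fderiv ℝ P x v)) (P x - w) = inner ℝ (T (P x - w)) (fderiv ℝ P x v) := by
    rw [hT, real_inner_comm]
  simp only [FunLike.coe_smul, ContinuousLinearMap.comp_apply, Pi.smul_apply,
    ContinuousLinearMap.prod_apply, fderivInnerCLM_apply, InnerProductSpace.toDual_apply_apply,
    ContinuousLinearMap.adjoint_inner_left, h4, smul_eq_mul]
  ring

/-- The Gauss–Newton form of the Hessian, exact where the residual vanishes. -/
theorem hessian_quadratic_comp {P : E → F} {T : F →L[ℝ] F}
    (hT : ∀ x y, inner ℝ (T x) y = inner ℝ x (T y)) (w : F) (c : ℝ) {x : E}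
    (hP : ContDiff ℝ 1 P) (hx : P x = w) :
    hessian (fun z => c + inner ℝ (T (P z - w)) (P z - w) / 2) x =
      (fderiv ℝ P x).adjoint.comp (T.comp (fderiv ℝ P x)) := by
  have hd := hP.differentiable one_ne_zero
  rw [hessian, gradient_eq fun z => hasGradientAt_quadratic_comp hT w c (hd z)]
  refine HasFDerivAt.fderiv (hasFDerivAt_apply_of_eq_zero
    (A := fun z => (fderiv ℝ P z).adjoint) (h := fun z => T (P z - w)) ?_ ?_ (by simp [hx]))
  · exact (ContinuousLinearMap.adjoint.continuous.comp
      (hP.continuous_fderiv one_ne_zero)).continuousAt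
  · exact T.hasFDerivAt.comp x ((hd x).hasFDerivAt.sub_const w)

/-- The norm of `J` enters through that of its adjoint, which has an explicit formula in the
application. -/
theorem sharpness_le_of_hessian {f : E → ℝ} {x : E} {J : E →L[ℝ] F} {T : F →L[ℝ] F}
    (hf : hessian f x = J.adjoint.comp (T.comp J)) {Λ C : ℝ} (hΛ : 0 ≤ Λ) (hC : 0 ≤ C)
    (hT : ∀ w, inner ℝ (T w) w ≤ Λ * ‖w‖ ^ 2) (hJ : ∀ w, ‖J.adjoint w‖ ^ 2 ≤ C * ‖w‖ ^ 2) :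
    sharpness f x ≤ Λ * C := by
  have hJ' : ∀ v, ‖J v‖ ^ 2 ≤ C * ‖v‖ ^ 2 := by
    intro v
    -- `‖J‖ = ‖J†‖`, in terms of bounds on squares
    have h1 : ‖J v‖ ^ 2 ≤ ‖J.adjoint (J v)‖ * ‖v‖ := by
      rw [← real_inner_self_eq_norm_sq, ← ContinuousLinearMap.adjoint_inner_left]
      exact real_inner_le_norm _ _
    have h2 := hJ (J v)
    rcases (sq_nonneg ‖J v‖).eq_or_lt with h0 | h0
    · rw [← h0]; positivity
    · refine le_of_mul_le_mul_left ?_ h0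
      calc ‖J v‖ ^ 2 * ‖J v‖ ^ 2 ≤ (‖J.adjoint (J v)‖ * ‖v‖) * (‖J.adjoint (J v)‖ * ‖v‖) :=
            mul_le_mul h1 h1 h0.le (by positivity)
        _ = ‖J.adjoint (J v)‖ ^ 2 * ‖v‖ ^ 2 := by ring
        _ ≤ C * ‖J v‖ ^ 2 * ‖v‖ ^ 2 := mul_le_mul_of_nonneg_right h2 (sq_nonneg _)
        _ = _ := by ring
  refine Real.sSup_le (fun μ hμ => ?_) (by positivity)
  obtain ⟨v, hv⟩ := Module.End.HasEigenvalue.exists_hasEigenvector hμ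
  have h1 : hessian f x v = μ • v := hv.apply_eq_smul
  have h2 : μ * ‖v‖ ^ 2 = inner ℝ (T (J v)) (J v) := by
    rw [← real_inner_self_eq_norm_sq, ← real_inner_smul_left, ← h1, hf]
    simp [ContinuousLinearMap.adjoint_inner_left]
  have h3 : 0 < ‖v‖ ^ 2 := by have := norm_pos_iff.2 hv.2; positivity
  refine le_of_mul_le_mul_right ?_ h3
  rw [h2]
  calc _ ≤ Λ * ‖J v‖ ^ 2 := hT _
    _ ≤ Λ * (C * ‖v‖ ^ 2) := mul_le_mul_of_nonneg_left (hJ' v) hΛ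
    _ = _ := by ring

/-- The Rayleigh quotient of the Hessian at `J† w`. -/
theorem le_sharpness_of_hessian [FiniteDimensional ℝ E] {f : E → ℝ} {x : E} {J : E →L[ℝ] F}
    {T : F →L[ℝ] F} (hf : hessian f x = J.adjoint.comp (T.comp J)) {l : ℝ} (hl : 0 ≤ l)
    (hTs : ∀ x y, inner ℝ (T x) y = inner ℝ x (T y))
    (hT : ∀ w, l * ‖w‖ ^ 2 ≤ inner ℝ (T w) w) {w : F} (hw : J.adjoint w ≠ 0) :
    l * ‖J.adjoint w‖ ^ 2 ≤ sharpness f x * ‖w‖ ^ 2 := by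
  have hs : LinearMap.IsSymmetric (hessian f x).toLinearMap := by
    intro u v
    simp [hf, ContinuousLinearMap.adjoint_inner_left, ContinuousLinearMap.adjoint_inner_right, hTs]
  set v := J.adjoint w with hv
  have h1 := inner_le_sSup_eigenvalueSet hs v
  have h2 : inner ℝ ((hessian f x).toLinearMap v) v = inner ℝ (T (J v)) (J v) := by
    simp [hf, ContinuousLinearMap.adjoint_inner_left]
  rw [h2] at h1
  change _ ≤ sharpness f x * _ at h1
  have h3 : ‖v‖ ^ 2 ≤ ‖J v‖ * ‖w‖ := by
    rw [← real_inner_self_eq_norm_sq, hv, ContinuousLinearMap.adjoint_inner_left, mul_comm]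
    exact real_inner_le_norm _ _
  have h4 : 0 < ‖v‖ ^ 2 := by have := norm_pos_iff.2 hw; positivity
  refine le_of_mul_le_mul_right ?_ h4
  calc l * ‖v‖ ^ 2 * ‖v‖ ^ 2 = l * (‖v‖ ^ 2 * ‖v‖ ^ 2) := by ring
    _ ≤ l * ((‖J v‖ * ‖w‖) * (‖J v‖ * ‖w‖)) :=
        mul_le_mul_of_nonneg_left (mul_le_mul h3 h3 h4.le (by positivity)) hl
    _ = l * ‖J v‖ ^ 2 * ‖w‖ ^ 2 := by ring
    _ ≤ sharpness f x * ‖v‖ ^ 2 * ‖w‖ ^ 2 :=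
        mul_le_mul_of_nonneg_right ((hT _).trans h1) (sq_nonneg _)
    _ = _ := by ring

end

/-! ### The derivative of the product vector -/

section

variable {L : ℕ} {d : ℕ → ℕ}

theorem contDiff_layer_apply (k : ℕ) (i : Fin (d (k + 1))) (j : Fin (d k)) :
    ContDiff ℝ 1 fun W : Params L d => layer W k i j := by
  unfold layer
  split_ifs with h
  · simp only [weight, of_apply]
    fun_prop
  · exact contDiff_const

theorem contDiff_bwdIter (m i : ℕ) : ContDiff ℝ 1 fun W : Params L d => bwdIter W m i := by
  induction m generalizing i with
  | zero => exact contDiff_const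
  | succ m ih =>
    rw [contDiff_pi]
    intro j
    simp only [bwdIter, mulVec, dotProduct, transpose_apply]
    exact ContDiff.sum fun l _ => (contDiff_layer_apply i l j).mul (contDiff_pi.1 (ih (i + 1)) l)

theorem contDiff_wProd_one : ContDiff ℝ 1 (wProd (L := L) (d := d) 1) := by
  have : wProd (L := L) (d := d) 1 = fun W => WithLp.toLp 2 (bwdIter W (L - 0) 0) :=
    funext wProd_one
  rw [this]
  exact (PiLp.contDiff_toLp (p := 2)).comp (contDiff_bwdIter _ _)

/-- The derivative of `bwdIter` at `W` in the direction `V`. -/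
def bwdIterDeriv (W V : Params L d) : ℕ → (i : ℕ) → Fin (d i) → ℝ
  | 0, _ => 0
  | m + 1, i => (layer V i)ᵀ *ᵥ bwdIter W m (i + 1) + (layer W i)ᵀ *ᵥ bwdIterDeriv W V m (i + 1)

theorem hasDerivAt_bwdIter (W V : Params L d) (m i : ℕ) :
    HasDerivAt (fun t : ℝ => bwdIter (W + t • V) m i) (bwdIterDeriv W V m i) 0 := by
  induction m generalizing i with
  | zero => exact hasDerivAt_const _ _
  | succ m ih =>
    rw [hasDerivAt_pi]
    intro j
    simp only [bwdIter, bwdIterDeriv, mulVec, dotProduct, transpose_apply, Pi.add_apply,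
      ← Finset.sum_add_distrib]
    refine HasDerivAt.fun_sum fun l _ => ?_
    have h1 : HasDerivAt (fun t : ℝ => layer (W + t • V) i l j) (layer V i l j) 0 := by
      simp only [layer_add_smul, Matrix.add_apply, Matrix.smul_apply, smul_eq_mul]
      simpa using ((hasDerivAt_id (0 : ℝ)).mul_const (layer V i l j)).const_add (layer W i l j)
    have h2 := h1.fun_mul (hasDerivAt_pi.1 (ih (i + 1)) l)
    simpa using h2

theorem dotProduct_bwdIterDeriv (W V : Params L d) (x : Fin (d 0) → ℝ) (j : ℕ) (hj : j ≤ L) :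
    x ⬝ᵥ bwdIterDeriv W V L 0 =
      (∑ k ∈ Finset.range j, fwd W x k ⬝ᵥ ((layer V k)ᵀ *ᵥ bwd W (k + 1))) +
        fwd W x j ⬝ᵥ bwdIterDeriv W V (L - j) j := by
  induction j with
  | zero => simp [fwd]
  | succ j ih =>
    rw [ih (Nat.le_of_succ_le hj), Finset.sum_range_succ]
    have : L - j = (L - (j + 1)) + 1 := by omega
    rw [this, bwdIterDeriv, dotProduct_add, fwd, bwd, add_assoc]
    congr 2
    rw [mulVec_transpose, dotProduct_comm, ← dotProduct_mulVec, dotProduct_comm]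

theorem adjoint_fderiv_wProd (W : Params L d) (x : EuclideanSpace ℝ (Fin (d 0))) :
    (fderiv ℝ (wProd 1) W).adjoint x = backprop W x := by
  refine ext_inner_right ℝ fun V => ?_
  rw [ContinuousLinearMap.adjoint_inner_left, inner_backprop]
  have h1 : HasDerivAt (fun t : ℝ => W + t • V) V 0 := by
    simpa using ((hasDerivAt_id (0 : ℝ)).smul_const V).const_add W
  have h2 : HasDerivAt (fun t : ℝ => wProd 1 (W + t • V)) (fderiv ℝ (wProd 1) W V) 0 := by
    refine HasFDerivAt.comp_hasDerivAt (0 : ℝ) (l := wProd 1) ?_ h1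
    simpa using (contDiff_wProd_one.differentiable one_ne_zero W).hasFDerivAt
  have h3 : HasDerivAt (fun t : ℝ => wProd 1 (W + t • V))
      (WithLp.toLp 2 (bwdIterDeriv W V L 0)) 0 := by
    simp only [wProd_one]
    exact ((PiLp.continuousLinearEquiv 2 ℝ fun _ : Fin (d 0) => ℝ).symm.toContinuousLinearMap
      ).hasFDerivAt.comp_hasDerivAt (0 : ℝ) (hasDerivAt_bwdIter W V L 0)
  have h4 := dotProduct_bwdIterDeriv W V x L le_rfl
  rw [Nat.sub_self, bwdIterDeriv, dotProduct_zero, add_zero] at h4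
  rw [h2.unique h3, ← h4, EuclideanSpace.inner_eq_star_dotProduct]
  simp [dotProduct_comm]

end

/-! ### Linear regression -/

section

variable {n m : ℕ} (X : Matrix (Fin n) (Fin m) ℝ) (y : EuclideanSpace ℝ (Fin n))

/-- The empirical covariance as an operator on the Euclidean space. -/
def covOp : EuclideanSpace ℝ (Fin m) →L[ℝ] EuclideanSpace ℝ (Fin m) :=
  Matrix.toEuclideanCLM (𝕜 := ℝ) (empCov X)

theorem inner_covOp_right (v w : EuclideanSpace ℝ (Fin m)) :
    inner ℝ v (covOp X w) = 1 / (n : ℝ) * inner ℝ (toEuclideanLin X v) (toEuclideanLin X w) := by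
  rw [covOp, inner_toEuclideanCLM, empCov, smul_mulVec, dotProduct_smul, ← mulVec_mulVec,
    dotProduct_mulVec, vecMul_transpose, EuclideanSpace.inner_eq_star_dotProduct]
  simp [toLpLin_apply, dotProduct_comm]

theorem covOp_symm (v w : EuclideanSpace ℝ (Fin m)) :
    inner ℝ (covOp X v) w = inner ℝ v (covOp X w) := by
  rw [real_inner_comm, inner_covOp_right, inner_covOp_right, real_inner_comm]

theorem inner_covOp_self (w : EuclideanSpace ℝ (Fin m)) :
    inner ℝ (covOp X w) w = 1 / (n : ℝ) * ‖toEuclideanLin X w‖ ^ 2 := by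
  rw [covOp_symm, inner_covOp_right, real_inner_self_eq_norm_sq]

theorem eigenvalueSet_covOp :
    eigenvalueSet (covOp X).toLinearMap = eigenvalueSet (Matrix.toLin' (empCov X)) := by
  ext μ
  constructor
  · intro h
    obtain ⟨v, hv⟩ := Module.End.HasEigenvalue.exists_hasEigenvector h
    refine Module.End.hasEigenvalue_of_hasEigenvector (x := v.ofLp) ⟨?_, ?_⟩
    · rw [Module.End.mem_eigenspace_iff]
      exact congrArg WithLp.ofLp hv.apply_eq_smul
    · simpa using hv.2
  · intro h
    obtain ⟨v, hv⟩ := Module.End.HasEigenvalue.exists_hasEigenvector h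
    refine Module.End.hasEigenvalue_of_hasEigenvector (x := WithLp.toLp 2 v) ⟨?_, ?_⟩
    · rw [Module.End.mem_eigenspace_iff]
      exact congrArg (WithLp.toLp 2) hv.apply_eq_smul
    · simpa using hv.2

theorem inner_covOp_le (w : EuclideanSpace ℝ (Fin m)) :
    inner ℝ (covOp X w) w ≤ covMax X * ‖w‖ ^ 2 := by
  rw [covMax, ← eigenvalueSet_covOp]
  exact inner_le_sSup_eigenvalueSet (T := (covOp X).toLinearMap) (covOp_symm X) w

variable {X}

theorem covOp_injective (hX : (empCov X).rank = m) : Function.Injective (covOp X) := by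
  have h1 : LinearMap.range (empCov X).mulVecLin = ⊤ := by
    apply Submodule.eq_top_of_finrank_eq
    simpa [Matrix.rank] using hX
  have h2 : Function.Injective (empCov X).mulVecLin :=
    LinearMap.injective_iff_surjective.2 (LinearMap.range_eq_top.1 h1)
  intro v w h
  exact (WithLp.ofLp_injective 2) (h2 (congrArg WithLp.ofLp h))

theorem zero_notMem_eigenvalueSet (hX : (empCov X).rank = m) :
    (0 : ℝ) ∉ eigenvalueSet (covOp X).toLinearMap := by
  intro h
  obtain ⟨v, hv⟩ := Module.End.HasEigenvalue.exists_hasEigenvector h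
  refine hv.2 (covOp_injective hX ?_)
  have := hv.apply_eq_smul
  rw [zero_smul] at this
  rw [map_zero]
  exact this

theorem covMin_eq (hX : (empCov X).rank = m) :
    covMin X = sInf (eigenvalueSet (covOp X).toLinearMap) := by
  rw [covMin, ← eigenvalueSet_covOp, Set.sdiff_singleton_eq_self (zero_notMem_eigenvalueSet hX)]

theorem covMin_mul_le (hX : (empCov X).rank = m) (w : EuclideanSpace ℝ (Fin m)) :
    covMin X * ‖w‖ ^ 2 ≤ inner ℝ (covOp X w) w := by
  rw [covMin_eq hX]
  exact sInf_eigenvalueSet_le_inner (T := (covOp X).toLinearMap) (covOp_symm X) w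

theorem covMin_pos (hX : (empCov X).rank = m) (hm : 0 < m) : 0 < covMin X := by
  have hs : LinearMap.IsSymmetric (covOp X).toLinearMap := covOp_symm X
  have hne : (eigenvalueSet (covOp X).toLinearMap).Nonempty :=
    ⟨_, hs.hasEigenvalue_eigenvalues finrank_euclideanSpace_fin ⟨0, hm⟩⟩
  have hmem := hne.csInf_mem (finite_eigenvalueSet _)
  rw [← covMin_eq hX] at hmem
  obtain ⟨v, hv⟩ := Module.End.HasEigenvalue.exists_hasEigenvector hmem
  have h1 : covOp X v = covMin X • v := hv.apply_eq_smul
  have h2 := inner_covOp_self X v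
  rw [h1, real_inner_smul_left, real_inner_self_eq_norm_sq] at h2
  have h3 : 0 < ‖v‖ := norm_pos_iff.2 hv.2
  have h4 : 0 ≤ covMin X * ‖v‖ ^ 2 := by rw [h2]; positivity
  have h5 : 0 ≤ covMin X := nonneg_of_mul_nonneg_left h4 (by positivity)
  refine lt_of_le_of_ne h5 fun h => zero_notMem_eigenvalueSet hX ?_
  rw [h]
  exact hmem

variable {y}

/-- Around a minimizer the linear risk is a pure quadratic form. -/
theorem linRisk_eq {w₀ : EuclideanSpace ℝ (Fin m)} (h₀ : w₀ ∈ argminSet (linRisk X y))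
    (w : EuclideanSpace ℝ (Fin m)) :
    linRisk X y w = linRisk X y w₀ + inner ℝ (covOp X (w - w₀)) (w - w₀) := by
  have hexp : ∀ h, linRisk X y (w₀ + h) = linRisk X y w₀
      - 2 * (1 / (n : ℝ) * inner ℝ (y - toEuclideanLin X w₀) (toEuclideanLin X h))
      + 1 / (n : ℝ) * ‖toEuclideanLin X h‖ ^ 2 := by
    intro h
    have h1 : y - WithLp.toLp 2 (X.mulVec (w₀ + h).ofLp) =
        (y - toEuclideanLin X w₀) - toEuclideanLin X h := by
      simp only [toLpLin_apply, WithLp.ofLp_add, mulVec_add, WithLp.toLp_add]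
      abel
    have h2 : linRisk X y w₀ = 1 / (n : ℝ) * ‖y - toEuclideanLin X w₀‖ ^ 2 := rfl
    rw [h2, linRisk, h1, norm_sub_sq_real]
    ring
  have hort : ∀ h, 1 / (n : ℝ) * inner ℝ (y - toEuclideanLin X w₀) (toEuclideanLin X h) = 0 := by
    intro h
    set b := 1 / (n : ℝ) * inner ℝ (y - toEuclideanLin X w₀) (toEuclideanLin X h) with hb
    set c := 1 / (n : ℝ) * ‖toEuclideanLin X h‖ ^ 2 with hc
    have hc0 : 0 ≤ c := by positivity
    have h1 : ∀ t : ℝ, 0 ≤ -2 * t * b + t ^ 2 * c := by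
      intro t
      have h2 := h₀ (w₀ + t • h)
      rw [hexp, map_smul, real_inner_smul_right, norm_smul, mul_pow, Real.norm_eq_abs, sq_abs] at h2
      have : 1 / (n : ℝ) * (t * inner ℝ (y - toEuclideanLin X w₀) (toEuclideanLin X h)) =
          t * b := by
        rw [hb]; ring
      have h3 : 1 / (n : ℝ) * (t ^ 2 * ‖toEuclideanLin X h‖ ^ 2) = t ^ 2 * c := by
        rw [hc]; ring
      rw [this, h3] at h2
      linarith
    -- a step short enough for the linear term to win, also when `c = 0`
    have h2 := h1 (b / (c + 1))
    have h3 : -2 * (b / (c + 1)) * b + (b / (c + 1)) ^ 2 * c =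
        -(b ^ 2 * (c + 2) / (c + 1) ^ 2) := by
      field_simp
      ring
    rw [h3] at h2
    have h4 : b ^ 2 * (c + 2) / (c + 1) ^ 2 ≤ 0 := by linarith
    by_contra hb0
    have : 0 < b ^ 2 * (c + 2) / (c + 1) ^ 2 := by positivity
    linarith
  have h := hexp (w - w₀)
  rw [hort, add_sub_cancel] at h
  rw [h, inner_covOp_self]
  ring

end

/-! ### The risk of the network and its sharpness at minimizers -/

section

variable {n L : ℕ} {d : ℕ → ℕ} {X : Matrix (Fin n) (Fin (d 0)) ℝ} {y : EuclideanSpace ℝ (Fin n)}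
  {w₀ : EuclideanSpace ℝ (Fin (d 0))}

theorem risk_eq (h₀ : w₀ ∈ argminSet (linRisk X y)) (W : Params L d) :
    risk X y 1 W = linRisk X y w₀ + inner ℝ (covOp X (wProd 1 W - w₀)) (wProd 1 W - w₀) :=
  linRisk_eq h₀ _

theorem two_covOp_symm (v w : EuclideanSpace ℝ (Fin (d 0))) :
    inner ℝ (((2 : ℝ) • covOp X) v) w = inner ℝ v (((2 : ℝ) • covOp X) w) := by
  simp [real_inner_smul_left, real_inner_smul_right, covOp_symm]

theorem risk_eq_quadratic_comp (h₀ : w₀ ∈ argminSet (linRisk X y)) :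
    (risk X y 1 : Params L d → ℝ) = fun W => linRisk X y w₀ +
      inner ℝ (((2 : ℝ) • covOp X) (wProd 1 W - w₀)) (wProd 1 W - w₀) / 2 := by
  funext W
  rw [risk_eq h₀]
  simp [real_inner_smul_left]

theorem hasGradientAt_risk (h₀ : w₀ ∈ argminSet (linRisk X y)) (W : Params L d) :
    HasGradientAt (risk X y 1) (backprop W ((2 : ℝ) • covOp X (wProd 1 W - w₀))) W := by
  rw [risk_eq_quadratic_comp h₀, ← WithLp.ofLp_smul 2, ← adjoint_fderiv_wProd]
  exact hasGradientAt_quadratic_comp two_covOp_symm w₀ _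
    (contDiff_wProd_one.differentiable one_ne_zero W)

theorem hessian_risk (h₀ : w₀ ∈ argminSet (linRisk X y)) {W : Params L d} (hW : wProd 1 W = w₀) :
    hessian (risk X y 1) W = (fderiv ℝ (wProd 1) W).adjoint.comp
      (((2 : ℝ) • covOp X).comp (fderiv ℝ (wProd 1) W)) := by
  rw [risk_eq_quadratic_comp h₀]
  exact hessian_quadratic_comp two_covOp_symm w₀ _ contDiff_wProd_one hW

theorem wProd_eq_of_risk_le (h₀ : w₀ ∈ argminSet (linRisk X y)) (hX : (empCov X).rank = d 0)
    (hd0 : 0 < d 0) {W : Params L d} (hW : risk X y 1 W ≤ linRisk X y w₀) : wProd 1 W = w₀ := by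
  rw [risk_eq h₀] at hW
  have h1 := covMin_mul_le hX (wProd 1 W - w₀)
  have h2 := covMin_pos hX hd0
  have h3 : ‖wProd 1 W - w₀‖ ^ 2 ≤ 0 := by
    by_contra! h
    have := mul_pos h2 h
    linarith
  rw [← sub_eq_zero, ← norm_eq_zero]
  exact pow_eq_zero_iff two_ne_zero |>.1 (le_antisymm h3 (sq_nonneg _))

theorem mem_argminSet_risk (h₀ : w₀ ∈ argminSet (linRisk X y)) {W : Params L d}
    (hW : wProd 1 W = w₀) : W ∈ argminSet (risk X y 1 : Params L d → ℝ) := by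
  intro V
  rw [risk, hW]
  exact h₀ _

theorem norm_sq_wProd (W : Params L d) : ‖wProd 1 W‖ ^ 2 = bwd W 0 ⬝ᵥ bwd W 0 := by
  rw [← dotProduct_self_eq_norm_sq, wProd_one]

end

section

variable {n N : ℕ} {d : ℕ → ℕ} {X : Matrix (Fin n) (Fin (d 0)) ℝ} {y : EuclideanSpace ℝ (Fin n)}
  {w₀ : EuclideanSpace ℝ (Fin (d 0))}

/-- The sharpness of every minimizer is at least `2 λ L ‖w⋆‖ ^ (2 - 2 / L)`, where `L = N + 1` and
`a = ‖w⋆‖ ^ (2 / L)`. -/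
theorem le_sharpness_risk (hd : d (N + 1) = 1) (h₀ : w₀ ∈ argminSet (linRisk X y))
    (hX : (empCov X).rank = d 0) (hd0 : 0 < d 0) {a : ℝ} (ha : 0 < a)
    (haw : a ^ (N + 1) = ‖w₀‖ ^ 2) {W : Params (N + 1) d} (hW : wProd 1 W = w₀) :
    2 * covMin X * ((N + 1) * a ^ N) ≤ sharpness (risk X y 1) W := by
  have hl := covMin_pos hX hd0
  have hw : w₀.ofLp = bwd W 0 := by rw [← hW, wProd_one]
  have h1 : (N + 1) * a ^ (2 * N + 1) ≤ ‖(fderiv ℝ (wProd 1) W).adjoint w₀‖ ^ 2 := by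
    rw [adjoint_fderiv_wProd, hw]
    exact le_norm_sq_backprop hd W ha (by rw [haw, ← norm_sq_wProd, hW])
  have h2 : (fderiv ℝ (wProd 1) W).adjoint w₀ ≠ 0 := by
    intro h
    rw [h, norm_zero] at h1
    have : 0 < (N + 1 : ℝ) * a ^ (2 * N + 1) := by positivity
    norm_num at h1
    linarith
  have h3 := le_sharpness_of_hessian (hessian_risk h₀ hW) (l := 2 * covMin X) (by positivity)
    two_covOp_symm (fun w => by
      have := covMin_mul_le hX w
      simp only [FunLike.coe_smul, Pi.smul_apply, real_inner_smul_left]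
      linarith) h2
  have h4 : 0 < ‖w₀‖ ^ 2 := by rw [← haw]; positivity
  refine le_of_mul_le_mul_right (le_trans ?_ h3) h4
  calc _ = 2 * covMin X * ((N + 1) * a ^ (2 * N + 1)) := by rw [← haw]; ring
    _ ≤ _ := mul_le_mul_of_nonneg_left h1 (by positivity)

/-- For an almost balanced minimizer the base of the power is close to `a`, and the bound is close
to the one of `le_sharpness_risk` with `Λ` in place of `λ`. -/
theorem sharpness_risk_le (hd : d (N + 1) = 1) (h₀ : w₀ ∈ argminSet (linRisk X y))
    (hΛ : 0 ≤ covMax X) {W : Params (N + 1) d} (hW : wProd 1 W = w₀) {δ : ℕ → ℝ}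
    (hδ0 : ∀ k, 0 ≤ δ k) (hδ : GapBound W δ) :
    sharpness (risk X y 1) W ≤
      2 * covMax X * ((N + 1) * (lastSq W + ∑ j ∈ Finset.range N, δ j) ^ N) := by
  have hc := add_nonneg (lastSq_nonneg W)
    (Finset.sum_nonneg fun j (_ : j ∈ Finset.range N) => hδ0 j)
  refine sharpness_le_of_hessian (hessian_risk h₀ hW) (by positivity) (by positivity)
    (fun w => ?_) fun w => ?_
  · have := inner_covOp_le X w
    simp only [FunLike.coe_smul, Pi.smul_apply, real_inner_smul_left]
    linarith
  · rw [adjoint_fderiv_wProd, ← dotProduct_self_eq_norm_sq]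
    exact norm_sq_backprop_le hd W hδ0 hδ _

end

open Filter Set

/-! ### Gradient flows -/

section

variable {E : Type*} [NormedAddCommGroup E] [InnerProductSpace ℝ E] [CompleteSpace E]
  {f : E → ℝ} {u : ℝ → E}

theorem IsGradientFlow.hasDerivWithinAt_comp (hu : IsGradientFlow f u) (hf : Differentiable ℝ f)
    {t : ℝ} (ht : 0 ≤ t) :
    HasDerivWithinAt (fun s => f (u s)) (-‖gradient f (u t)‖ ^ 2) (Ici 0) t := by
  have h := (hf (u t)).hasGradientAt.hasFDerivAt.comp_hasDerivWithinAt t (hu t ht)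
  have h1 : (InnerProductSpace.toDual ℝ E (gradient f (u t))) (-gradient f (u t)) =
      -‖gradient f (u t)‖ ^ 2 := by
    rw [InnerProductSpace.toDual_apply_apply, inner_neg_right, real_inner_self_eq_norm_sq]
  rw [h1] at h
  exact h

theorem IsGradientFlow.continuousOn (hu : IsGradientFlow f u) : ContinuousOn u (Ici 0) :=
  fun t ht => (hu t ht).continuousWithinAt

theorem IsGradientFlow.antitoneOn (hu : IsGradientFlow f u) (hf : Differentiable ℝ f) :
    AntitoneOn (fun s => f (u s)) (Ici 0) := by
  have h : ∀ t ∈ interior (Ici (0 : ℝ)), HasDerivAt (fun s => f (u s))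
      (-‖gradient f (u t)‖ ^ 2) t := by
    intro t ht
    rw [interior_Ici] at ht
    exact (hu.hasDerivWithinAt_comp hf (le_of_lt ht)).hasDerivAt (Ici_mem_nhds ht)
  refine antitoneOn_of_deriv_nonpos (convex_Ici 0)
    (fun t ht => (hu.hasDerivWithinAt_comp hf ht).continuousWithinAt)
    (fun t ht => (h t ht).differentiableAt.differentiableWithinAt) fun t ht => ?_
  rw [(h t ht).deriv]
  have := sq_nonneg ‖gradient f (u t)‖
  linarith

/-- Otherwise `f ∘ u` is constant, so that its one-sided derivative at `0` vanishes. -/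
theorem IsGradientFlow.exists_lt (hu : IsGradientFlow f u) (hf : Differentiable ℝ f)
    (h0 : gradient f (u 0) ≠ 0) : ∃ t, 0 ≤ t ∧ f (u t) < f (u 0) := by
  by_contra! h
  have hconst : ∀ t ∈ Ici (0 : ℝ), f (u t) = f (u 0) := fun t ht =>
    le_antisymm (hu.antitoneOn hf self_mem_Ici ht ht) (h t ht)
  have h1 : HasDerivWithinAt (fun s => f (u s)) 0 (Ici 0) 0 :=
    (hasDerivWithinAt_const (0 : ℝ) (Ici 0) (f (u 0))).congr hconst rfl
  have h2 := (uniqueDiffOn_Ici (0 : ℝ) 0 self_mem_Ici).eq_deriv _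
    (hu.hasDerivWithinAt_comp hf le_rfl) h1
  rw [neg_eq_zero, pow_eq_zero_iff two_ne_zero, norm_eq_zero] at h2
  exact h0 h2

/-- A gradient flow that satisfies a Polyak–Łojasiewicz inequality eventually, and along which the
squared gradient is bounded by the excess value, converges: the excess value decays
exponentially, so that the speed is integrable. -/
theorem IsGradientFlow.exists_tendsto (hu : IsGradientFlow f u) (hf : Differentiable ℝ f)
    (hf' : Continuous (gradient f)) {t₀ m μ K : ℝ} (ht₀ : 0 ≤ t₀) (hμ : 0 < μ) (hK : 0 ≤ K)
    (hlow : ∀ t, t₀ ≤ t → μ * (f (u t) - m) ≤ ‖gradient f (u t)‖ ^ 2)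
    (hupp : ∀ t, t₀ ≤ t → ‖gradient f (u t)‖ ^ 2 ≤ K * (f (u t) - m)) :
    ∃ x, Tendsto u atTop (nhds x) ∧ f x ≤ m := by
  have hderiv : ∀ t, t₀ < t → HasDerivAt (fun s => f (u s)) (-‖gradient f (u t)‖ ^ 2) t :=
    fun t ht => (hu.hasDerivWithinAt_comp hf (ht₀.trans ht.le)).hasDerivAt
      (Ici_mem_nhds (ht₀.trans_lt ht))
  have hg : ∀ t, t₀ < t → HasDerivAt (fun s => (f (u s) - m) * Real.exp (μ * s))
      (-‖gradient f (u t)‖ ^ 2 * Real.exp (μ * t) +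
        (f (u t) - m) * (Real.exp (μ * t) * μ)) t := by
    intro t ht
    have h1 : HasDerivAt (fun s : ℝ => Real.exp (μ * s)) (Real.exp (μ * t) * μ) t := by
      simpa using ((hasDerivAt_id t).const_mul μ).exp
    exact ((hderiv t ht).sub_const m).fun_mul h1
  have hanti : AntitoneOn (fun s => (f (u s) - m) * Real.exp (μ * s)) (Ici t₀) := by
    refine antitoneOn_of_deriv_nonpos (convex_Ici t₀) ?_ ?_ ?_
    · have h1 : ContinuousOn (fun s => f (u s)) (Ici t₀) :=
        hf.continuous.comp_continuousOn (hu.continuousOn.mono (Ici_subset_Ici.2 ht₀))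
      exact (h1.sub continuousOn_const).mul (by fun_prop)
    · intro t ht
      rw [interior_Ici] at ht
      exact (hg t ht).differentiableAt.differentiableWithinAt
    · intro t ht
      rw [interior_Ici] at ht
      rw [(hg t ht).deriv]
      have h1 := mul_le_mul_of_nonneg_right (hlow t (le_of_lt ht)) (Real.exp_pos (μ * t)).le
      linarith
  set C := (f (u t₀) - m) * Real.exp (μ * t₀) with hC
  have hdecay : ∀ t, t₀ ≤ t → f (u t) - m ≤ C * Real.exp (-μ * t) := by
    intro t ht
    have h1 : (f (u t) - m) * Real.exp (μ * t) ≤ C := hanti self_mem_Ici ht ht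
    have h2 := mul_le_mul_of_nonneg_right h1 (Real.exp_pos (-μ * t)).le
    have h3 : Real.exp (μ * t) * Real.exp (-μ * t) = 1 := by rw [← Real.exp_add]; simp
    rwa [mul_assoc, h3, mul_one] at h2
  have hspeed : ∀ t, t₀ ≤ t →
      ‖-gradient f (u t)‖ ≤ √(K * C) * Real.exp (-(μ / 2) * t) := by
    intro t ht
    have h1 : ‖gradient f (u t)‖ ^ 2 ≤ K * C * Real.exp (-μ * t) := by
      have := mul_le_mul_of_nonneg_left (hdecay t ht) hK
      have h2 := hupp t ht
      linarith
    have h2 : Real.exp (-μ * t) = Real.exp (-(μ / 2) * t) ^ 2 := by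
      rw [← Real.exp_nat_mul]
      congr 1
      push_cast
      ring
    have hKC : 0 ≤ K * C := by
      refine nonneg_of_mul_nonneg_left (le_trans (sq_nonneg _) h1) (Real.exp_pos _)
    rw [norm_neg]
    refine abs_le_of_sq_le_sq' ?_ (by positivity) |>.2
    rw [mul_pow, Real.sq_sqrt hKC, ← h2]
    exact h1
  have hint : MeasureTheory.IntegrableOn (fun t => -gradient f (u t)) (Ioi t₀) := by
    refine MeasureTheory.Integrable.mono' (g := fun t => √(K * C) * Real.exp (-(μ / 2) * t))
      ((exp_neg_integrableOn_Ioi t₀ (by positivity)).const_mul _) ?_ ?_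
    · refine ContinuousOn.aestronglyMeasurable ?_ measurableSet_Ioi
      exact (hf'.comp_continuousOn (hu.continuousOn.mono
        fun t ht => ht₀.trans (le_of_lt ht))).neg
    · refine (MeasureTheory.ae_restrict_iff' measurableSet_Ioi).2
        (MeasureTheory.ae_of_all _ fun t ht => ?_)
      exact hspeed t (le_of_lt ht)
  have hlim := MeasureTheory.tendsto_limUnder_of_hasDerivAt_of_integrableOn_Ioi
    (fun t (ht : t₀ < t) => (hu t (ht₀.trans ht.le)).hasDerivAt
      (Ici_mem_nhds (ht₀.trans_lt ht))) hint
  refine ⟨_, hlim, ?_⟩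
  have h1 : Tendsto (fun t => f (u t)) atTop (nhds (f (limUnder atTop u))) :=
    (hf.continuous.tendsto _).comp hlim
  have h2 : Tendsto (fun t => m + C * Real.exp (-μ * t)) atTop (nhds (m + C * 0)) := by
    refine ((Real.tendsto_exp_atBot.comp ?_).const_mul C).const_add m
    exact tendsto_id.const_mul_atTop_of_neg (neg_neg_of_pos hμ)
  rw [mul_zero, add_zero] at h2
  refine le_of_tendsto_of_tendsto h1 h2 ?_
  filter_upwards [eventually_ge_atTop t₀] with t ht
  have := hdecay t ht
  linarith

end

/-! ### The gradient flow of the network -/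

section

variable {n L : ℕ} {d : ℕ → ℕ} {X : Matrix (Fin n) (Fin (d 0)) ℝ} {y : EuclideanSpace ℝ (Fin n)}
  {w₀ : EuclideanSpace ℝ (Fin (d 0))} {W : ℝ → Params L d}

theorem hasDerivWithinAt_layer {V : Params L d} {s : Set ℝ} {t : ℝ}
    (h : HasDerivWithinAt W V s t) (k : ℕ) (i : Fin (d (k + 1))) (j : Fin (d k)) :
    HasDerivWithinAt (fun r => layer (W r) k i j) (layer V k i j) s t := by
  unfold layer
  split_ifs with hk
  · exact (EuclideanSpace.proj (𝕜 := ℝ) (⟨⟨k, hk⟩, (i, j)⟩ :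
      Σ k : Fin L, Fin (d (k + 1)) × Fin (d k))).hasFDerivAt.comp_hasDerivWithinAt t h
  · exact hasDerivWithinAt_const _ _ _

theorem layer_neg (V : Params L d) (k : ℕ) : layer (-V) k = -layer V k := by
  have := layer_add_smul 0 V (-1) k
  have h0 : layer (0 : Params L d) k = 0 := by
    unfold layer
    split_ifs
    · ext i j; simp [weight]
    · rfl
  simpa [h0] using this

/-- The imbalance of two layers does not change when the layers move along a direction of the
form `backprop`. -/
theorem hasDerivWithinAt_gap {x : Fin (d 0) → ℝ} {s : Set ℝ} {t : ℝ}
    (h : HasDerivWithinAt W (-backprop (W t) x) s t) {k : ℕ} (hk : k + 1 < L)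
    (i j : Fin (d (k + 1))) : HasDerivWithinAt (fun r => gap (W r) k i j) 0 s t := by
  have h1 : HasDerivWithinAt (fun r => ∑ l, layer (W r) k i l * layer (W r) k j l)
      (-(bwd (W t) (k + 1) i * fwd (W t) x (k + 1) j +
        fwd (W t) x (k + 1) i * bwd (W t) (k + 1) j)) s t := by
    refine (HasDerivWithinAt.fun_sum (u := Finset.univ) fun l _ =>
      (hasDerivWithinAt_layer h k i l).fun_mul (hasDerivWithinAt_layer h k j l)).congr_deriv ?_
    simp only [layer_neg, layer_backprop (W t) x (by omega : k < L), Matrix.neg_apply,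
      vecMulVec_apply, fwd, mulVec, dotProduct, Finset.mul_sum, Finset.sum_mul,
      ← Finset.sum_add_distrib, ← Finset.sum_neg_distrib]
    refine Finset.sum_congr rfl fun l _ => ?_
    ring
  have h2 : HasDerivWithinAt (fun r => ∑ l, layer (W r) (k + 1) l i * layer (W r) (k + 1) l j)
      (-(fwd (W t) x (k + 1) i * bwd (W t) (k + 1) j +
        bwd (W t) (k + 1) i * fwd (W t) x (k + 1) j)) s t := by
    refine (HasDerivWithinAt.fun_sum (u := Finset.univ) fun l _ =>
      (hasDerivWithinAt_layer h (k + 1) l i).fun_mul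
        (hasDerivWithinAt_layer h (k + 1) l j)).congr_deriv ?_
    simp only [layer_neg, layer_backprop (W t) x hk, Matrix.neg_apply,
      vecMulVec_apply, bwd_of_lt (W t) (by omega : k + 1 < L), mulVec, dotProduct,
      transpose_apply, Finset.mul_sum, Finset.sum_mul,
      ← Finset.sum_add_distrib, ← Finset.sum_neg_distrib]
    refine Finset.sum_congr rfl fun l _ => ?_
    ring
  have h3 := (h1.fun_sub h2).congr_deriv (show _ = (0 : ℝ) by ring)
  refine h3.congr_of_eventuallyEq ?_ ?_
  · filter_upwards with r
    simp [gap, Matrix.sub_apply, Matrix.mul_apply]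
  · simp [gap, Matrix.sub_apply, Matrix.mul_apply]

theorem gap_eq_of_flow (h₀ : w₀ ∈ argminSet (linRisk X y)) (hW : IsGradientFlow (risk X y 1) W)
    {k : ℕ} (hk : k + 1 < L) {t : ℝ} (ht : 0 ≤ t) : gap (W t) k = gap (W 0) k := by
  ext i j
  have h1 : ∀ r, 0 ≤ r → HasDerivWithinAt (fun r => gap (W r) k i j) 0 (Ici 0) r := by
    intro r hr
    have h2 := hW r hr
    rw [(hasGradientAt_risk h₀ (W r)).gradient] at h2
    exact hasDerivWithinAt_gap h2 hk i j
  refine constant_of_has_deriv_right_zero (f := fun r => gap (W r) k i j) (a := 0) (b := t)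
    (fun r hr => (h1 r hr.1).continuousWithinAt.mono Icc_subset_Ici_self)
    (fun r hr => (h1 r hr.1).mono (Ici_subset_Ici.2 hr.1)) t ⟨ht, le_rfl⟩

theorem continuous_gap_apply (k : ℕ) (i j : Fin (d (k + 1))) :
    Continuous fun V : Params L d => gap V k i j := by
  simp only [gap, Matrix.sub_apply, Matrix.mul_apply, transpose_apply]
  exact (continuous_finsetSum _ fun l _ => (contDiff_layer_apply k i l).continuous.mul
    (contDiff_layer_apply k j l).continuous).sub
    (continuous_finsetSum _ fun l _ => (contDiff_layer_apply (k + 1) l i).continuous.mul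
    (contDiff_layer_apply (k + 1) l j).continuous)

theorem gap_eq_of_tendsto (h₀ : w₀ ∈ argminSet (linRisk X y))
    (hW : IsGradientFlow (risk X y 1) W) {V : Params L d} (hV : Tendsto W atTop (nhds V))
    {k : ℕ} (hk : k + 1 < L) : gap V k = gap (W 0) k := by
  ext i j
  refine tendsto_nhds_unique (((continuous_gap_apply k i j).tendsto V).comp hV)
    (tendsto_const_nhds.congr' ?_)
  filter_upwards [eventually_ge_atTop 0] with t ht
  simp [gap_eq_of_flow h₀ hW hk ht]

theorem gapBound_of_gap_eq {V W₀ : Params L d} (h : ∀ k, k + 1 < L → gap V k = gap W₀ k) :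
    GapBound V fun k => opNorm (gap W₀ k) := by
  intro k hk x
  rw [h k hk]
  exact abs_dotProduct_mulVec_le_opNorm _ x

theorem differentiable_risk (h₀ : w₀ ∈ argminSet (linRisk X y)) :
    Differentiable ℝ (risk X y 1 : Params L d → ℝ) :=
  fun V => (hasGradientAt_risk h₀ V).differentiableAt

theorem continuous_gradient_risk (h₀ : w₀ ∈ argminSet (linRisk X y)) :
    Continuous (gradient (risk X y 1 : Params L d → ℝ)) := by
  have h1 : gradient (risk X y 1 : Params L d → ℝ) = fun V =>
      (fderiv ℝ (wProd 1) V).adjoint (((2 : ℝ) • covOp X) (wProd 1 V - w₀)) := by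
    funext V
    rw [(hasGradientAt_risk h₀ V).gradient, adjoint_fderiv_wProd]
    rfl
  rw [h1]
  have h2 := contDiff_wProd_one (L := L) (d := d)
  exact (ContinuousLinearMap.adjoint.continuous.comp (h2.continuous_fderiv one_ne_zero)).clm_apply
    (((2 : ℝ) • covOp X).continuous.comp (h2.continuous.sub continuous_const))

end

section

variable {n N : ℕ} {d : ℕ → ℕ} {X : Matrix (Fin n) (Fin (d 0)) ℝ} {y : EuclideanSpace ℝ (Fin n)}
  {w₀ : EuclideanSpace ℝ (Fin (d 0))}

theorem wProd_zero : wProd 1 (0 : Params (N + 1) d) = 0 := by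
  rw [wProd_one, bwd_of_lt _ N.succ_pos, layer_of_lt _ N.succ_pos]
  have : weight (0 : Params (N + 1) d) ⟨0, N.succ_pos⟩ = 0 := by ext i j; simp [weight]
  rw [this]
  simp

/-- Below the risk of the zero network, the product vector stays away from zero. -/
theorem exists_le_norm_sq_wProd (h₀ : w₀ ∈ argminSet (linRisk X y)) {b : ℝ}
    (hb : b < risk X y 1 (0 : Params (N + 1) d)) :
    ∃ κ, 0 < κ ∧ ∀ V : Params (N + 1) d, risk X y 1 V ≤ b → κ ≤ ‖wProd 1 V‖ ^ 2 := by
  have hc : Continuous (linRisk X y) := by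
    have : linRisk X y = fun w => linRisk X y w₀ + inner ℝ (covOp X (w - w₀)) (w - w₀) :=
      funext fun w => linRisk_eq h₀ w
    rw [this]
    fun_prop
  rw [risk, wProd_zero] at hb
  obtain ⟨r, hr, hball⟩ := Metric.mem_nhds_iff.1 ((isOpen_lt continuous_const hc).mem_nhds hb)
  refine ⟨r ^ 2, by positivity, fun V hV => ?_⟩
  by_contra! h
  have h1 : ‖wProd 1 V‖ < r := lt_of_pow_lt_pow_left₀ 2 hr.le h
  have h2 : b < linRisk X y (wProd 1 V) := hball (by simpa using h1)
  exact absurd hV (not_le.2 h2)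

theorem lastSq_le (hd : d (N + 1) = 1) {V : Params (N + 1) d} {δ : ℕ → ℝ} (hδ0 : ∀ k, 0 ≤ δ k)
    (hδ : GapBound V δ) {b : ℝ} (hb : ‖wProd 1 V‖ ^ 2 ≤ b) :
    lastSq V ≤ ∑ j ∈ Finset.range N, δ j + 1 + b := by
  by_contra! h
  have hb0 := (sq_nonneg _).trans hb
  have h1 := pow_le_bwd_zero_sq hd V hδ0 hδ (by linarith)
  rw [← norm_sq_wProd] at h1
  have h2 : 1 ≤ lastSq V - ∑ j ∈ Finset.range N, δ j := by linarith
  have h3 := le_self_pow₀ h2 (by omega : N + 1 ≠ 0)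
  linarith

/-- Upper bound on the gradient and Polyak–Łojasiewicz inequality, in terms of bounds on the
layers and on the product vector. -/
theorem gradient_risk_bounds (hd : d (N + 1) = 1) (h₀ : w₀ ∈ argminSet (linRisk X y))
    (hX : (empCov X).rank = d 0) (hd0 : 0 < d 0) {V : Params (N + 1) d} {δ : ℕ → ℝ}
    (hδ0 : ∀ k, 0 ≤ δ k) (hδ : GapBound V δ) {c κ : ℝ} (hc : 0 < c)
    (hVc : lastSq V + ∑ j ∈ Finset.range N, δ j ≤ c) (hκ : κ ≤ ‖wProd 1 V‖ ^ 2) :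
    κ / c * (4 * covMin X) * (risk X y 1 V - linRisk X y w₀) ≤ ‖gradient (risk X y 1) V‖ ^ 2 ∧
    ‖gradient (risk X y 1) V‖ ^ 2 ≤
      (N + 1) * c ^ N * (4 * ‖covOp X‖ ^ 2 / covMin X) * (risk X y 1 V - linRisk X y w₀) := by
  have hs0 := add_nonneg (lastSq_nonneg V)
    (Finset.sum_nonneg fun j (_ : j ∈ Finset.range N) => hδ0 j)
  have hl := covMin_pos hX hd0
  rw [(hasGradientAt_risk h₀ V).gradient, risk_eq h₀, add_sub_cancel_left]
  set h := wProd 1 V - w₀ with hh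
  set g := (2 : ℝ) • covOp X h with hg
  have hgn : ‖g‖ ^ 2 = 4 * ‖covOp X h‖ ^ 2 := by
    rw [hg, norm_smul]; norm_num; ring
  set Q := inner ℝ (covOp X h) h with hQ
  have hlow : covMin X * ‖h‖ ^ 2 ≤ Q := covMin_mul_le hX h
  have hQ0 : 0 ≤ Q := le_trans (by positivity) hlow
  have hCS : Q ≤ ‖covOp X h‖ * ‖h‖ := real_inner_le_norm _ _
  constructor
  · have h1 : covMin X * Q ≤ ‖covOp X h‖ ^ 2 := by
      rcases hQ0.eq_or_lt with h0 | h0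
      · rw [← h0, mul_zero]; positivity
      · refine le_of_mul_le_mul_right ?_ h0
        calc covMin X * Q * Q = covMin X * (Q * Q) := by ring
          _ ≤ covMin X * ((‖covOp X h‖ * ‖h‖) * (‖covOp X h‖ * ‖h‖)) :=
            mul_le_mul_of_nonneg_left (mul_le_mul hCS hCS h0.le (by positivity)) hl.le
          _ = ‖covOp X h‖ ^ 2 * (covMin X * ‖h‖ ^ 2) := by ring
          _ ≤ ‖covOp X h‖ ^ 2 * Q := mul_le_mul_of_nonneg_left hlow (sq_nonneg _)
    -- the block of the first layer alone gives the lower bound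
    have h2 : (bwd V 1 ⬝ᵥ bwd V 1) * ‖g‖ ^ 2 ≤ ‖backprop V g‖ ^ 2 := by
      rw [norm_sq_backprop, ← dotProduct_self_eq_norm_sq]
      exact Finset.single_le_sum (f := fun k => (bwd V (k + 1) ⬝ᵥ bwd V (k + 1)) *
        (fwd V g.ofLp k ⬝ᵥ fwd V g.ofLp k))
        (fun k _ => mul_nonneg (real_dotProduct_self_nonneg _) (real_dotProduct_self_nonneg _))
        (Finset.mem_range.2 N.succ_pos)
    have h3 : κ / c ≤ bwd V 1 ⬝ᵥ bwd V 1 := by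
      rw [div_le_iff₀ hc]
      have h4 := layer_transpose_sq_le hd V hδ0 hδ N.zero_le (bwd V 1)
      rw [← bwd_of_lt V N.succ_pos, ← norm_sq_wProd] at h4
      have h5 := mul_le_mul_of_nonneg_right hVc (real_dotProduct_self_nonneg (bwd V 1))
      exact hκ.trans (h4.trans (h5.trans_eq (mul_comm _ _)))
    calc κ / c * (4 * covMin X) * Q = κ / c * (4 * (covMin X * Q)) := by ring
      _ ≤ (bwd V 1 ⬝ᵥ bwd V 1) * (4 * (covMin X * Q)) :=
        mul_le_mul_of_nonneg_right h3 (by positivity)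
      _ ≤ (bwd V 1 ⬝ᵥ bwd V 1) * ‖g‖ ^ 2 := by
        rw [hgn]
        exact mul_le_mul_of_nonneg_left (by linarith) (real_dotProduct_self_nonneg _)
      _ ≤ _ := h2
  · have h1 := norm_sq_backprop_le hd V hδ0 hδ g.ofLp
    rw [dotProduct_self_eq_norm_sq, hgn] at h1
    refine h1.trans ?_
    have h2 : ‖covOp X h‖ ^ 2 ≤ ‖covOp X‖ ^ 2 / covMin X * Q := by
      rw [div_mul_eq_mul_div, le_div_iff₀ hl]
      calc ‖covOp X h‖ ^ 2 * covMin X ≤ (‖covOp X‖ * ‖h‖) ^ 2 * covMin X := by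
            gcongr
            exact (covOp X).le_opNorm h
        _ = ‖covOp X‖ ^ 2 * (covMin X * ‖h‖ ^ 2) := by ring
        _ ≤ _ := mul_le_mul_of_nonneg_left hlow (sq_nonneg _)
    calc _ ≤ (N + 1) * c ^ N * (4 * (‖covOp X‖ ^ 2 / covMin X * Q)) := by gcongr
      _ = _ := by ring

/-- The gradient flow started below the risk of the zero network, away from critical points,
converges to parameters with product vector `w⋆`. -/
theorem exists_tendsto_flow (hd : d (N + 1) = 1) (h₀ : w₀ ∈ argminSet (linRisk X y))
    (hX : (empCov X).rank = d 0) (hd0 : 0 < d 0) {W : ℝ → Params (N + 1) d}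
    (hW : IsGradientFlow (risk X y 1) W)
    (hinit : risk X y 1 (W 0) ≤ risk X y 1 (0 : Params (N + 1) d))
    (hgrad : gradient (risk X y 1) (W 0) ≠ 0) :
    ∃ V, Tendsto W atTop (nhds V) ∧ wProd 1 V = w₀ := by
  have hdiff := differentiable_risk (L := N + 1) h₀
  have hl := covMin_pos hX hd0
  obtain ⟨t₀, ht₀, hlt⟩ := hW.exists_lt hdiff hgrad
  obtain ⟨κ, hκ, hκW⟩ := exists_le_norm_sq_wProd h₀ (hlt.trans_le hinit)
  set δ : ℕ → ℝ := fun k => opNorm (gap (W 0) k) with hδdef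
  have hδ0 : ∀ k, 0 ≤ δ k := fun k => norm_nonneg _
  have hδ : ∀ t, 0 ≤ t → GapBound (W t) δ := fun t ht =>
    gapBound_of_gap_eq fun k hk => gap_eq_of_flow h₀ hW hk ht
  set b := 2 * ((risk X y 1 (W 0) - linRisk X y w₀) / covMin X) + 2 * ‖w₀‖ ^ 2 with hb
  have hbound : ∀ t, 0 ≤ t → ‖wProd 1 (W t)‖ ^ 2 ≤ b := by
    intro t ht
    have h1 : risk X y 1 (W t) ≤ risk X y 1 (W 0) := hW.antitoneOn hdiff self_mem_Ici ht ht
    have h2 := covMin_mul_le hX (wProd 1 (W t) - w₀)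
    have h3 := risk_eq h₀ (W t)
    have h4 : ‖wProd 1 (W t) - w₀‖ ^ 2 ≤ (risk X y 1 (W 0) - linRisk X y w₀) / covMin X := by
      rw [le_div_iff₀ hl]
      linarith
    have h5 : ‖wProd 1 (W t)‖ ^ 2 ≤ (‖wProd 1 (W t) - w₀‖ + ‖w₀‖) ^ 2 := by
      have := norm_add_le (wProd 1 (W t) - w₀) w₀
      rw [sub_add_cancel] at this
      gcongr
    have h6 := add_sq_le (a := ‖wProd 1 (W t) - w₀‖) (b := ‖w₀‖)
    linarith
  have hb0 : 0 ≤ b := (sq_nonneg _).trans (hbound 0 le_rfl)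
  have hδs : 0 ≤ ∑ j ∈ Finset.range N, δ j := Finset.sum_nonneg fun j _ => hδ0 j
  set c := (∑ j ∈ Finset.range N, δ j + 1 + b) + ∑ j ∈ Finset.range N, δ j with hc
  have hc0 : 0 < c := by positivity
  have hbounds := fun t (ht : t₀ ≤ t) =>
    gradient_risk_bounds hd h₀ hX hd0 hδ0 (hδ t (ht₀.trans ht)) hc0
      (add_le_add_left (lastSq_le hd hδ0 (hδ t (ht₀.trans ht)) (hbound t (ht₀.trans ht))) _)
      (hκW (W t) (hW.antitoneOn hdiff ht₀ (ht₀.trans ht) ht))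
  obtain ⟨V, hV, hVm⟩ := hW.exists_tendsto hdiff (continuous_gradient_risk h₀) ht₀
    (by positivity : 0 < κ / c * (4 * covMin X)) (by positivity)
    (fun t ht => (hbounds t ht).1) (fun t ht => (hbounds t ht).2)
  exact ⟨V, hV, wProd_eq_of_risk_le h₀ hX hd0 hVm⟩

/-! ### Comparison of sharpness -/

theorem two_mul_sum_opNorm_gap_le (W : Params (N + 1) d) :
    2 * ∑ k ∈ Finset.range N, opNorm (gap W k) ≤ initEps W := by
  have h1 : 0 ≤ ⨆ k, frobSq (weight W k) := Real.iSup_nonneg fun k =>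
    Finset.sum_nonneg fun i _ => Finset.sum_nonneg fun j _ => sq_nonneg _
  have h2 : ∑ k ∈ Finset.range N, opNorm (gap W k) =
      ∑ k : Fin (N + 1), if h : (k : ℕ) + 1 < N + 1 then
      opNorm (weight W k * (weight W k).transpose -
        (weight W ⟨k + 1, h⟩).transpose * weight W ⟨k + 1, h⟩)
      else 0 := by
    rw [Fin.sum_univ_castSucc, Finset.sum_range]
    simp only [Fin.val_last, lt_irrefl, dite_false, add_zero]
    refine Finset.sum_congr rfl fun k _ => ?_
    have hk : (k : ℕ) + 1 < N + 1 := by omega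
    rw [dif_pos (by simp), gap, layer_of_lt W (by omega : (k : ℕ) < N + 1), layer_of_lt W hk]
    rfl
  rw [initEps, ← h2]
  linarith

end

end DeepLinear

end

theorem corollary2 (n L : ℕ) (hL : 1 ≤ L) (d : ℕ → ℕ) (hd : d L = 1)
    (X : Matrix (Fin n) (Fin (d 0)) ℝ) (y : EuclideanSpace ℝ (Fin n))
    (wstar : EuclideanSpace ℝ (Fin (d 0)))
    (hwstar : DeepLinear.IsLeastNormSolution X y wstar)
    (R : DeepLinear.Params L d → ℝ)
    (hR : R = DeepLinear.risk X y (1 : Fin (d L) → ℝ))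
    (W : ℝ → DeepLinear.Params L d)
    (hflow : DeepLinear.IsGradientFlow R W)
    -- first assumption, on the initialization
    (hinit : R (W 0) ≤ R 0)
    (hgrad : gradient R (W 0) ≠ 0)
    -- second assumption
    (hrank : (DeepLinear.empCov X).rank = d 0)
    (heps : DeepLinear.initEps (W 0) ≤ 1)
    (hnorm : 1 ≤ ‖wstar‖)
    (hepsL : 32 * (L : ℝ) * Real.sqrt (DeepLinear.initEps (W 0)) ≤ 1) :
    ∃ WSI : DeepLinear.Params L d,
      Filter.Tendsto W Filter.atTop (nhds WSI) ∧
      WSI ∈ DeepLinear.argminSet R ∧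
      1 ≤ DeepLinear.sharpness R WSI / DeepLinear.minSharpness R ∧
      DeepLinear.sharpness R WSI / DeepLinear.minSharpness R ≤
        4 * (DeepLinear.covMax X / DeepLinear.covMin X) := by
  open DeepLinear in
  obtain ⟨N, rfl⟩ : ∃ N, L = N + 1 := ⟨L - 1, by omega⟩
  subst hR
  have h₀ := hwstar.1
  have hd0 : 0 < d 0 := by
    by_contra! h
    have : IsEmpty (Fin (d 0)) := by rw [Nat.le_zero.1 h]; infer_instance
    rw [Subsingleton.elim wstar 0, norm_zero] at hnorm
    norm_num at hnorm
  have hl := covMin_pos hrank hd0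
  have hw1 : 1 ≤ ‖wstar‖ ^ 2 := one_le_pow₀ hnorm
  have hlΛ : covMin X ≤ covMax X :=
    le_of_mul_le_mul_right ((covMin_mul_le hrank wstar).trans (inner_covOp_le X wstar))
      (by linarith)
  obtain ⟨V, hV, hVw⟩ := exists_tendsto_flow hd h₀ hrank hd0 hflow hinit hgrad
  have hVmin := mem_argminSet_risk h₀ hVw
  -- `a = ‖w⋆‖ ^ (2 / L)`, the squared norm of each layer of a balanced rank-one solution
  obtain ⟨a, ha1, haw⟩ : ∃ a : ℝ, 1 ≤ a ∧ a ^ (N + 1) = ‖wstar‖ ^ 2 :=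
    ⟨(‖wstar‖ ^ 2) ^ (((N + 1 : ℕ) : ℝ)⁻¹), Real.one_le_rpow hw1 (by positivity),
      Real.rpow_inv_natCast_pow (by positivity) N.succ_ne_zero⟩
  have ha : 0 < a := by linarith
  have hlow : ∀ U ∈ argminSet (risk X y 1 : Params (N + 1) d → ℝ),
      2 * covMin X * ((N + 1) * a ^ N) ≤ sharpness (risk X y 1) U := by
    intro U hU
    refine le_sharpness_risk hd h₀ hrank hd0 ha haw (wProd_eq_of_risk_le h₀ hrank hd0 ?_)
    have := hU V
    rwa [show risk X y 1 V = linRisk X y wstar by rw [risk, hVw]] at this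
  have hmin_le : minSharpness (risk X y 1 : Params (N + 1) d → ℝ) ≤ sharpness (risk X y 1) V :=
    csInf_le ⟨_, by rintro _ ⟨U, hU, rfl⟩; exact hlow U hU⟩ ⟨V, hVmin, rfl⟩
  have hle_min : 2 * covMin X * ((N + 1) * a ^ N) ≤
      minSharpness (risk X y 1 : Params (N + 1) d → ℝ) :=
    le_csInf ⟨_, V, hVmin, rfl⟩ (by rintro _ ⟨U, hU, rfl⟩; exact hlow U hU)
  have hpos : 0 < 2 * covMin X * ((N + 1) * a ^ N) := by positivity
  refine ⟨V, hV, hVmin, (one_le_div (hpos.trans_le hle_min)).2 hmin_le, ?_⟩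
  set δ : ℕ → ℝ := fun k => opNorm (gap (W 0) k) with hδdef
  have hδ0 : ∀ k, 0 ≤ δ k := fun k => norm_nonneg _
  have hδ : GapBound V δ := gapBound_of_gap_eq fun k hk => gap_eq_of_tendsto h₀ hflow hV hk
  set D := ∑ j ∈ Finset.range N, δ j with hD
  have hD0 : 0 ≤ D := Finset.sum_nonneg fun j _ => hδ0 j
  set ε := initEps (W 0) with hε
  have hDε : 2 * D ≤ ε := two_mul_sum_opNorm_gap_le (W 0)
  have hε0 : 0 ≤ ε := by linarith
  have hlast : lastSq V - D ≤ a := by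
    by_contra! h
    have h1 := pow_le_bwd_zero_sq hd V hδ0 hδ (by linarith)
    rw [← norm_sq_wProd, hVw, ← haw] at h1
    exact absurd h1 (not_le.2 (pow_lt_pow_left₀ h ha.le N.succ_ne_zero))
  -- here `2 D ≤ ε` and `1 ≤ a`
  have hlast' : lastSq V + D ≤ a * (1 + ε) := by nlinarith
  -- `ε ≤ √ε` because `ε ≤ 1`
  have hεN : ε * N ≤ 1 := by
    have h1 : ε ≤ √ε := Real.le_sqrt_of_sq_le (by nlinarith)
    have h2 : ε * N ≤ √ε * N := mul_le_mul_of_nonneg_right h1 N.cast_nonneg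
    push_cast at hepsL
    have h3 : 0 ≤ √ε * N := by positivity
    nlinarith [Real.sqrt_nonneg ε]
  have hpow : (1 + ε) ^ N ≤ 4 := by
    calc (1 + ε) ^ N ≤ Real.exp ε ^ N := by
          gcongr
          linarith [Real.add_one_le_exp ε]
      _ = Real.exp (ε * N) := by rw [← Real.exp_nat_mul, mul_comm]
      _ ≤ Real.exp 1 := Real.exp_le_exp.2 hεN
      _ ≤ 4 := by linarith [Real.exp_one_lt_d9]
  have hupp : sharpness (risk X y 1) V ≤ 2 * covMax X * ((N + 1) * (a ^ N * 4)) := by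
    refine (sharpness_risk_le hd h₀ (hl.le.trans hlΛ) hVw hδ0 hδ).trans ?_
    have hΛ := hl.le.trans hlΛ
    have h0 : 0 ≤ lastSq V + D := add_nonneg (lastSq_nonneg V) hD0
    have h1 : (lastSq V + D) ^ N ≤ a ^ N * 4 := by
      calc (lastSq V + D) ^ N ≤ (a * (1 + ε)) ^ N := by gcongr
        _ = a ^ N * (1 + ε) ^ N := mul_pow _ _ _
        _ ≤ _ := by gcongr
    gcongr
  calc _ ≤ 2 * covMax X * ((N + 1) * (a ^ N * 4)) / (2 * covMin X * ((N + 1) * a ^ N)) := by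
        have hΛ := hl.le.trans hlΛ
        gcongr
    _ = _ := by field_simp
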